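/- **Setting.** Tasks $t=1,2,\dots$ have hidden independent states $Y(t)$, uniform on $\{-1,1\}$. A committee is a sequence of experts with competences $p_1,p_2,\dots\in[0,1]$, $q_i=1-p_i$; given $Y(t)$ the opinions $X_i(t)\in\{-1,1\}$ are independent, and $X_i(t)=Y(t)$ with probability $p_i$ whatever the value of $Y(t)$; different tasks are independent. For a finite set of voters, $V$ denotes their majority vote, $V(x)=\operatorname{sign}\sum_i x_i$, with ties broken in an arbitrary manner fixed in advance. The committee is *consistent* if $P(V(X_1,\dots,X_n)=Y)\to1$ as $n\to\infty$; its *rate* is $a_N=\inf_{n\ge N}P(V(X_1,\dots,X_n)=Y)$, and $\rho_N=\frac{1-a_N}{a_N-1/2}$. It is *absolutely balanced* with parameter $\gamma\in(0,\tfrac12)$ if $p_i\in(\gamma,1-\gamma)$ for all $i$. Let $\Phi=\sum_{i=1}^N(p_i-\tfrac12)\log\frac{p_i}{q_i}$. For a committee of size $N$ and a block of $T\ge1$ tasks, the empirical pseudo competence of expert $i\le N$ is the frequency of agreement with the majority vote of the other $N-1$ members, $$\tilde p_i(T)=\frac1T\sum_{t=1}^T \mathbf 1\{X_i(t)=V((X_j(t))_{j\le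 N,\,j\ne i})\},$$ and the block empirical pseudo naïve Bayes rule is $$f^B(\mathbf X(t))=\operatorname{sign}\Big(\sum_{i=1}^N X_i(t)\,w(\tilde p_i(T))\Big),\qquad w(x)=\log\frac{x}{1-x},$$ where $\operatorname{sign}(0)\in\{-1,1\}$ and the real values that replace $w(0)$ and $w(1)$ are arbitrary. **Theorem.** For every sequence of competences $(p_i)$ there is a committee size $n^*$, depending only on $(p_i)$, such that the following holds for all $N>n^*$ if the committee is consistent with rate $a_N$. For all $T\ge 1$ and $\delta\in(0,1)$ put $C(\delta;N,T)=\frac{12}{T}\log\frac{8N}{\delta}$. For every $$\varepsilon\in\Big(\big(\rho_N\,C(\delta;N,T)\big)^{1/3},\ \min\{5,\,2\Phi/N\}\Big),$$ if the committee is absolutely balanced with a parameter $$\gamma> C(\delta;N,T)\Big(\frac{2}{\sqrt{4\varepsilon+1}-1}\Big)^2,$$ then for every task $t$ $$P\big(f^B(\mathbf X(t))\ne Y(t)\big)\le\delta+\exp\Big[-\frac{(2\Phi-\varepsilon N)^2}{8\Phi}\Big].$$ -/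

import Mathlib

open MeasureTheory ProbabilityTheory Filter Topology

noncomputable section

/-- The sign of a real number, with value `tie` at zero. -/
def signWithTie (tie x : ℝ) : ℝ :=
  if 0 < x then 1 else if x < 0 then -1 else tie

/-- The probability law of hidden binary states `Y t` of the tasks `t = 0, 1, 2, …` and of the
opinions `X i t` of the experts `i = 0, 1, 2, …` on them, for a committee with competences `p i`:
the states are uniform on `{-1, 1}`; given the state of a task, the opinions on that task are
independent, each one being equal to the state with probability `p i`; different tasks are
independent. -/
structure IsOpinionModel {Ω : Type*} [MeasurableSpace Ω] (μ : Measure Ω)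
    (p : ℕ → ℝ) (Y : ℕ → Ω → ℝ) (X : ℕ → ℕ → Ω → ℝ) : Prop where
  measurable_state : ∀ t, Measurable (Y t)
  measurable_opinion : ∀ i t, Measurable (X i t)
  state_values : ∀ t ω, Y t ω = 1 ∨ Y t ω = -1
  opinion_values : ∀ i t ω, X i t ω = 1 ∨ X i t ω = -1
  uniform_prior : ∀ t, ∀ y : ℝ, y = 1 ∨ y = -1 → μ.real {ω | Y t ω = y} = 1 / 2
  competence : ∀ i t, ∀ y : ℝ, y = 1 ∨ y = -1 →
    (μ[|{ω | Y t ω = y}]).real {ω | X i t ω = y} = p i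
  opinions_condIndep : ∀ t, ∀ y : ℝ, y = 1 ∨ y = -1 →
    iIndepFun (fun i => X i t) (μ[|{ω | Y t ω = y}])
  tasks_indep : iIndepFun (fun t ω => (Y t ω, fun i => X i t ω)) μ

/-- The majority vote of a finite set `A` of voters with opinions `x i`. A tie is broken by the
value `tie A`. -/
def majorityVote (tie : Finset ℕ → ℝ) (A : Finset ℕ) (x : ℕ → ℝ) : ℝ :=
  signWithTie (tie A) (∑ i ∈ A, x i)

/-- The probability that the majority vote of the first `n` experts is the true state. All tasks
have the same law; the task `0` is used. -/
def majorityAccuracy {Ω : Type*} [MeasurableSpace Ω] (μ : Measure Ω)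
    (Y : ℕ → Ω → ℝ) (X : ℕ → ℕ → Ω → ℝ) (tie : ℕ → Finset ℕ → ℝ) (n : ℕ) : ℝ :=
  μ.real {ω | majorityVote (tie 0) (Finset.range n) (fun i => X i 0 ω) = Y 0 ω}

/-- Consistency of the committee under majority voting. -/
def IsConsistent {Ω : Type*} [MeasurableSpace Ω] (μ : Measure Ω)
    (Y : ℕ → Ω → ℝ) (X : ℕ → ℕ → Ω → ℝ) (tie : ℕ → Finset ℕ → ℝ) : Prop :=
  Tendsto (majorityAccuracy μ Y X tie) atTop (𝓝 1)

/-- The rate of consistency `a_N = inf_{n ≥ N} P(V(X_1, …, X_n) = Y)`. -/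
def consistencyRate {Ω : Type*} [MeasurableSpace Ω] (μ : Measure Ω)
    (Y : ℕ → Ω → ℝ) (X : ℕ → ℕ → Ω → ℝ) (tie : ℕ → Finset ℕ → ℝ) (N : ℕ) : ℝ :=
  ⨅ n : Set.Ici N, majorityAccuracy μ Y X tie n

/-- `ρ_N = (1 - a_N) / (a_N - 1/2)` as a function of `a = a_N`. -/
def rateRatio (a : ℝ) : ℝ := (1 - a) / (a - 1 / 2)

/-- The committee is absolutely balanced with balancing parameter `γ`. -/
def IsAbsolutelyBalanced (p : ℕ → ℝ) (γ : ℝ) : Prop :=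
  γ ∈ Set.Ioo (0 : ℝ) (1 / 2) ∧ ∀ i, p i ∈ Set.Ioo γ (1 - γ)

/-- The committee potential `Φ` of the first `N` experts. -/
def committeePotential (p : ℕ → ℝ) (N : ℕ) : ℝ :=
  ∑ i ∈ Finset.range N, (p i - 1 / 2) * Real.log (p i / (1 - p i))

/-- `C(δ; N, T) = (12 / T) log (8 N / δ)`. -/
def sampleConstant (δ : ℝ) (N T : ℕ) : ℝ := 12 / (T : ℝ) * Real.log (8 * N / δ)

open Classical in
/-- The empirical pseudo competence of expert `i` in the committee of the first `N` experts: the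
fraction of the tasks `0, …, T - 1` on which the expert agrees with the majority vote of the other
members. -/
def empiricalPseudoCompetence {Ω : Type*} (X : ℕ → ℕ → Ω → ℝ) (tie : ℕ → Finset ℕ → ℝ)
    (N T i : ℕ) (ω : Ω) : ℝ :=
  1 / (T : ℝ) * ∑ t ∈ Finset.range T,
    if X i t ω = majorityVote (tie t) ((Finset.range N).erase i) (fun j => X j t ω)
    then (1 : ℝ) else 0

/-- The weight `log (x / (1 - x))`. It is infinite at `x = 0` and `x = 1`, where a rule has to
replace it by real values `w₀` and `w₁` of its choice. -/
def logOddsWeight (w₀ w₁ x : ℝ) : ℝ :=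
  if x = 0 then w₀ else if x = 1 then w₁ else Real.log (x / (1 - x))

/-- The decision of the block empirical pseudo naïve Bayes rule on the task `t`, with the weights
estimated over the block of tasks `0, …, T - 1`. The value `tieB` is used when the weighted sum is
zero. -/
def blockRule {Ω : Type*} (X : ℕ → ℕ → Ω → ℝ) (tie : ℕ → Finset ℕ → ℝ)
    (tieB w₀ w₁ : ℝ) (N T t : ℕ) (ω : Ω) : ℝ :=
  signWithTie tieB (∑ i ∈ Finset.range N,
    X i t ω * logOddsWeight w₀ w₁ (empiricalPseudoCompetence X tie N T i ω))

end

/-!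
The accuracy of a majority vote depends on the competences only through the expected sign `c` of
the number of correct minus the number of wrong votes, and the agreement rate of expert `i` with the
majority of the others has mean `(1 + c_i (2 p_i - 1)) / 2`, where `c_i` is `c` for the committee
without `i`. In a consistent committee all `c_i` are close to `c` and to `1`, so the pseudo weights
`2 artanh (c_i (2 p_i - 1))` are nearly proportional to the optimal weights
`2 a_i = 2 artanh (2 p_i - 1)`; a weighted vote does not change when all weights are divided by `c`.
The Chernoff bound for the weighted vote has the factors `cosh (a_i - 2 l b_i) / cosh a_i`, and the
strict concavity of `log (cosh √x)` gains a term of order `a_i ^ 4` that pays for the remaining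
error in the weights `b_i`. The empirical weights differ from the pseudo weights by at most
`97 / 100 * ε` except with probability `δ`, by Chernoff bounds for the `T` tasks.
-/

section Hyperbolic

theorem add_pow_three_div_six_le_sinh {y : ℝ} (hy : 0 ≤ y) : y + y ^ 3 / 6 ≤ Real.sinh y := by
  have h := sum_le_hasSum (Finset.range 2) (fun n _ => by positivity) (Real.hasSum_sinh y)
  norm_num [Finset.sum_range_succ, Nat.factorial] at h
  exact h

theorem hasDerivAt_tanh (x : ℝ) : HasDerivAt Real.tanh (1 / Real.cosh x ^ 2) x := by
  have h := (Real.hasDerivAt_sinh x).div (Real.hasDerivAt_cosh x) (Real.cosh_pos x).ne'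
  have hfun : Real.tanh = Real.sinh / Real.cosh := funext Real.tanh_eq_sinh_div_cosh
  rw [← Real.cosh_sq_sub_sinh_sq x, hfun, sq, sq]
  simpa only [sq] using h

theorem abs_tanh_le_abs (x : ℝ) : |Real.tanh x| ≤ |x| := by
  have hderiv : ∀ y ∈ Set.univ, ‖1 / Real.cosh y ^ 2‖ ≤ 1 := fun y _ => by
    rw [Real.norm_of_nonneg (by positivity)]
    exact div_le_one_of_le₀ (one_le_pow₀ (Real.one_le_cosh y)) (by positivity)
  simpa using convex_univ.norm_image_sub_le_of_norm_hasDerivWithin_le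
    (fun y _ => (hasDerivAt_tanh y).hasDerivWithinAt) hderiv (Set.mem_univ 0) (Set.mem_univ x)

theorem mul_tanh_nonneg (x : ℝ) : 0 ≤ x * Real.tanh x := by
  rw [Real.tanh_eq_sinh_div_cosh, ← mul_div_assoc]
  refine div_nonneg ?_ (Real.cosh_pos x).le
  rcases le_total 0 x with h | h
  · exact mul_nonneg h (Real.sinh_nonneg_iff.2 h)
  · exact mul_nonneg_of_nonpos_of_nonpos h (Real.sinh_nonpos_iff.2 h)

theorem two_thirds_mul_pow_three_le_sinh_mul_cosh_sub {x : ℝ} (hx : 0 ≤ x) :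
    2 / 3 * x ^ 3 ≤ Real.sinh x * Real.cosh x - x := by
  have h := add_pow_three_div_six_le_sinh (y := 2 * x) (by positivity)
  rw [Real.sinh_two_mul] at h
  linarith

theorem antitoneOn_tanh_div_add_sq (M : ℝ) :
    AntitoneOn (fun x => Real.tanh x / x + 1 / (3 * Real.cosh M ^ 2) * x ^ 2) (Set.Ioc 0 M) := by
  have hderiv : ∀ x : ℝ, 0 < x → HasDerivAt
      (fun x => Real.tanh x / x + 1 / (3 * Real.cosh M ^ 2) * x ^ 2)
      (2 / 3 * x / Real.cosh M ^ 2 -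
        (Real.sinh x * Real.cosh x - x) / (x ^ 2 * Real.cosh x ^ 2)) x := by
    intro x hx
    have h := ((hasDerivAt_tanh x).div (hasDerivAt_id' x) hx.ne').add
      (((hasDerivAt_id' x).pow 2).const_mul (1 / (3 * Real.cosh M ^ 2)))
    refine h.congr_deriv ?_
    have hcosh := (Real.cosh_pos x).ne'
    have hcoshM := (Real.cosh_pos M).ne'
    rw [Real.tanh_eq_sinh_div_cosh]
    field_simp
    ring
  refine antitoneOn_of_deriv_nonpos (convex_Ioc 0 M)
    (fun x hx => (hderiv x hx.1).continuousAt.continuousWithinAt)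
    (fun x hx => (hderiv x (interior_subset hx).1).differentiableAt.differentiableWithinAt) ?_
  intro x hx
  obtain ⟨hx0, hxM⟩ := interior_subset hx
  rw [(hderiv x hx0).deriv, sub_nonpos]
  have := Real.cosh_pos x
  have hcosh_le : Real.cosh x ≤ Real.cosh M := by
    rwa [Real.cosh_le_cosh, abs_of_pos hx0, abs_of_pos (hx0.trans_le hxM)]
  calc 2 / 3 * x / Real.cosh M ^ 2 ≤ 2 / 3 * x / Real.cosh x ^ 2 := by gcongr
    _ = 2 / 3 * x ^ 3 / (x ^ 2 * Real.cosh x ^ 2) := by field_simp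
    _ ≤ _ := by gcongr; exact two_thirds_mul_pow_three_le_sinh_mul_cosh_sub hx0.le

theorem hasDerivAt_log_cosh_sqrt_add {y : ℝ} (hy : 0 < y) (k : ℝ) :
    HasDerivAt (fun y => Real.log (Real.cosh √y) + k * y ^ 2)
      (1 / 2 * (Real.tanh √y / √y + 4 * k * √y ^ 2)) y := by
  have hcosh := Real.cosh_pos √y
  have := Real.sqrt_pos.2 hy
  have h := (((Real.hasDerivAt_sqrt hy.ne').cosh).log hcosh.ne').add
    (((hasDerivAt_id' y).pow 2).const_mul k)
  refine h.congr_deriv ?_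
  rw [Real.tanh_eq_sinh_div_cosh, Real.sq_sqrt hy.le]
  field_simp
  ring

theorem concaveOn_log_cosh_sqrt_add_sq {M : ℝ} (hM : 0 ≤ M) :
    ConcaveOn ℝ (Set.Icc 0 (M ^ 2))
      (fun y => Real.log (Real.cosh √y) + 1 / (12 * Real.cosh M ^ 2) * y ^ 2) := by
  have hcont : Continuous
      (fun y => Real.log (Real.cosh √y) + 1 / (12 * Real.cosh M ^ 2) * y ^ 2) := by
    have := Real.continuous_cosh.comp Real.continuous_sqrt
    exact (this.log fun y => (Real.cosh_pos _).ne').add (by fun_prop)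
  refine AntitoneOn.concaveOn_of_deriv (convex_Icc _ _) hcont.continuousOn ?_ ?_ <;>
    rw [interior_Icc]
  · exact fun y hy => (hasDerivAt_log_cosh_sqrt_add hy.1 _).differentiableAt.differentiableWithinAt
  · intro y hy z hz hyz
    rw [(hasDerivAt_log_cosh_sqrt_add hy.1 _).deriv, (hasDerivAt_log_cosh_sqrt_add hz.1 _).deriv]
    have hmem : ∀ x ∈ Set.Ioo 0 (M ^ 2), √x ∈ Set.Ioc 0 M := fun x hx =>
      ⟨Real.sqrt_pos.2 hx.1, Real.sqrt_le_iff.2 ⟨hM, hx.2.le⟩⟩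
    have h := antitoneOn_tanh_div_add_sq M (hmem y hy) (hmem z hz) (Real.sqrt_le_sqrt hyz)
    have hk : 4 * (1 / (12 * Real.cosh M ^ 2)) = 1 / (3 * Real.cosh M ^ 2) := by
      have := (Real.cosh_pos M).ne'
      field_simp
      norm_num
    rw [hk]
    gcongr

theorem le_add_mul_sub_of_concaveOn {s : Set ℝ} {f : ℝ → ℝ} {f' x y : ℝ} (hf : ConcaveOn ℝ s f)
    (hx : x ∈ s) (hy : y ∈ s) (hf' : HasDerivAt f f' x) : f y ≤ f x + f' * (y - x) := by
  rcases lt_trichotomy x y with hxy | rfl | hxy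
  · have h := hf.slope_le_of_hasDerivAt hx hy hxy hf'
    rw [slope_def_field, div_le_iff₀ (sub_pos.2 hxy)] at h
    linarith
  · simp
  · have h := hf.le_slope_of_hasDerivAt hy hx hxy hf'
    rw [slope_def_field, le_div_iff₀ (sub_pos.2 hxy)] at h
    linarith

-- The Kearns–Saul inequality is the tangent bound for the concave function `log (cosh √y)` at
-- `a ^ 2`; the last term is the gap that strong concavity adds on bounded sets.
theorem log_cosh_le_tangent_sub_sq {M a v : ℝ} (ha : a ≠ 0) (haM : |a| ≤ M) (hvM : |v| ≤ M) :
    Real.log (Real.cosh v) ≤ Real.log (Real.cosh a) + Real.tanh a / a / 2 * (v ^ 2 - a ^ 2)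
      - 1 / (12 * Real.cosh M ^ 2) * (v ^ 2 - a ^ 2) ^ 2 := by
  have hM : 0 ≤ M := (abs_nonneg a).trans haM
  have hmem : ∀ x : ℝ, |x| ≤ M → x ^ 2 ∈ Set.Icc 0 (M ^ 2) := fun x hx =>
    ⟨sq_nonneg x, sq_abs x ▸ pow_le_pow_left₀ (abs_nonneg x) hx 2⟩
  have h := le_add_mul_sub_of_concaveOn (concaveOn_log_cosh_sqrt_add_sq hM) (hmem a haM)
    (hmem v hvM) (hasDerivAt_log_cosh_sqrt_add (pow_pos (abs_pos.2 ha) 2 |>.trans_eq (sq_abs a)) _)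
  have htanh : Real.tanh |a| / |a| = Real.tanh a / a := by
    rcases abs_choice a with h | h <;> simp [h, Real.tanh_neg]
  simp only [Real.sqrt_sq_eq_abs, Real.cosh_abs, htanh, sq_abs] at h
  linear_combination h

theorem cosh_sub_div_cosh (a u : ℝ) :
    Real.cosh (a - u) / Real.cosh a =
      (1 + Real.tanh a) / 2 * Real.exp (-u) + (1 - Real.tanh a) / 2 * Real.exp u := by
  have := (Real.cosh_pos a).ne'
  rw [Real.cosh_sub, Real.tanh_eq_sinh_div_cosh, ← Real.cosh_sub_sinh u, ← Real.cosh_add_sinh u]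
  field_simp
  ring

end Hyperbolic

section Artanh

theorem hasSum_artanh {x : ℝ} (hx : |x| < 1) :
    HasSum (fun k : ℕ => x ^ (2 * k + 1) / (2 * k + 1)) (Real.artanh x) := by
  obtain ⟨h1, h2⟩ := abs_lt.1 hx
  rw [Real.artanh_eq_half_log ⟨h1.le, h2.le⟩, Real.log_div (by linarith) (by linarith)]
  refine ((Real.hasSum_log_sub_log_of_abs_lt_one hx).mul_left (1 / 2)).congr_fun fun k => ?_
  ring

theorem abs_artanh {x : ℝ} (hx : |x| < 1) : |Real.artanh x| = Real.artanh |x| := by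
  rcases le_total 0 x with h | h
  · rw [abs_of_nonneg h, abs_of_nonneg (Real.artanh_nonneg h)]
  · rw [abs_of_nonpos h, abs_of_nonpos (Real.artanh_nonpos h)]
    apply Real.tanh_injective
    rw [Real.tanh_neg, Real.tanh_artanh (abs_lt.1 hx),
      Real.tanh_artanh (abs_lt.1 (by rwa [abs_neg]))]

theorem abs_le_abs_artanh {x : ℝ} (hx : |x| < 1) : |x| ≤ |Real.artanh x| := by
  simpa only [Real.tanh_artanh (abs_lt.1 hx)] using abs_tanh_le_abs (Real.artanh x)

theorem log_div_one_sub_eq_artanh {x : ℝ} (hx : x ∈ Set.Ioo (0 : ℝ) 1) :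
    Real.log (x / (1 - x)) = 2 * Real.artanh (2 * x - 1) := by
  rw [Real.artanh_eq_half_log ⟨by linarith [hx.1], by linarith [hx.2]⟩,
    show 1 + (2 * x - 1) = 2 * x by ring, show 1 - (2 * x - 1) = 2 * (1 - x) by ring,
    mul_div_mul_left _ _ two_ne_zero]
  ring

theorem log_one_add_div_one_sub_le {r : ℝ} (hr : 0 ≤ r) (hr' : r ≤ 22 / 25) :
    Real.log ((1 + r) / (1 - r)) ≤ 2 * r + 4 * r ^ 2 := by
  have hmem : r ∈ Set.Ioo (-1 : ℝ) 1 := ⟨by linarith, by linarith⟩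
  have hlog : Real.log ((1 + r) / (1 - r)) = 2 * Real.artanh r := by
    rw [Real.artanh_eq_half_log (Set.Ioo_subset_Icc_self hmem)]
    ring
  have hsinh : Real.artanh r ≤ r / √(1 - r ^ 2) := by
    rw [← Real.sinh_artanh hmem]
    exact Real.self_le_sinh_iff.2 (Real.artanh_nonneg hr)
  have hpos : 0 < 1 - r ^ 2 := by nlinarith
  have hsqrt : 1 ≤ (1 + 2 * r) * √(1 - r ^ 2) := by
    refine (one_le_sq_iff₀ (by positivity)).1 ?_
    rw [mul_pow, Real.sq_sqrt hpos.le]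
    have : 0 ≤ 4 + 3 * r - 4 * r ^ 2 - 4 * r ^ 3 := by
      nlinarith [mul_nonneg hr (sub_nonneg.2 hr'), mul_nonneg hr (mul_nonneg hr (sub_nonneg.2 hr'))]
    linear_combination r * this
  have hdiv : r / √(1 - r ^ 2) ≤ r * (1 + 2 * r) := by
    rw [div_le_iff₀ (Real.sqrt_pos.2 hpos), mul_assoc]
    exact le_mul_of_one_le_right hr hsqrt
  rw [hlog]
  linear_combination 2 * hsinh + 2 * hdiv

-- Compare the power series of the two sides and use `1 - c ^ (2 * k) ≤ k * (1 - c ^ 2)`.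
theorem abs_artanh_mul_div_sub_artanh_le {c m : ℝ} (hc : c ∈ Set.Ioc (0 : ℝ) 1) (hm : |m| < 1) :
    |Real.artanh (c * m) / c - Real.artanh m| ≤
      (1 - c ^ 2) * (m ^ 2 / (1 - m ^ 2) ^ 2) * |m| := by
  obtain ⟨hc0, hc1⟩ := hc
  have hcm : |c * m| < 1 := by
    rw [abs_mul, abs_of_pos hc0]
    exact (mul_le_of_le_one_left (abs_nonneg m) hc1).trans_lt hm
  have hm2 : ‖m ^ 2‖ < 1 := by
    rw [Real.norm_of_nonneg (sq_nonneg m)]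
    exact (sq_lt_one_iff_abs_lt_one m).2 hm
  have hseries := ((hasSum_artanh hcm).div_const c).sub (hasSum_artanh hm)
  have hmajorant :=
    ((hasSum_coe_mul_geometric_of_norm_lt_one hm2).mul_left (1 - c ^ 2)).mul_right |m|
  refine hseries.norm_le_of_bounded hmajorant fun k => ?_
  have hbernoulli : 1 - (c ^ 2) ^ k ≤ k * (1 - c ^ 2) := by
    have h := one_add_mul_le_pow (a := c ^ 2 - 1) (by nlinarith) k
    rw [add_sub_cancel] at h
    linarith
  have hpow : (c ^ 2) ^ k ≤ 1 := pow_le_one₀ (sq_nonneg c) (pow_le_one₀ hc0.le hc1)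
  have hterm : (c * m) ^ (2 * k + 1) / (2 * k + 1) / c - m ^ (2 * k + 1) / (2 * k + 1) =
      -((1 - (c ^ 2) ^ k) / (2 * k + 1) * (m ^ 2) ^ k * m) := by
    have : (2 * k + 1 : ℝ) ≠ 0 := by positivity
    field_simp
    ring
  rw [hterm, norm_neg, norm_mul, norm_mul, Real.norm_of_nonneg (by positivity : 0 ≤ (m ^ 2) ^ k),
    Real.norm_of_nonneg (div_nonneg (sub_nonneg.2 hpow) (by positivity)), Real.norm_eq_abs]
  have hfactor : (1 - (c ^ 2) ^ k) / (2 * k + 1) ≤ k * (1 - c ^ 2) :=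
    (div_le_self (sub_nonneg.2 hpow) (by linarith [k.cast_nonneg (α := ℝ)])).trans hbernoulli
  calc (1 - (c ^ 2) ^ k) / (2 * k + 1) * (m ^ 2) ^ k * |m|
      ≤ k * (1 - c ^ 2) * (m ^ 2) ^ k * |m| := by gcongr
    _ = (1 - c ^ 2) * (k * (m ^ 2) ^ k) * |m| := by ring

end Artanh

section Cumulant

variable {a b l τ : ℝ}

theorem tanh_div_mul_sq_sub_sq_le (ha : a ≠ 0) (hl : l ∈ Set.Icc (0 : ℝ) (1 / 2))
    (hb : |b - a| ≤ τ * |a|) :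
    Real.tanh a / a / 2 * ((a - 2 * l * b) ^ 2 - a ^ 2) ≤
      2 * (a * Real.tanh a) * (l ^ 2 - l + τ * l * (1 - 2 * l)) + 2 * l ^ 2 * (b - a) ^ 2 := by
  obtain ⟨hl0, hl1⟩ := hl
  set t := Real.tanh a / a with ht
  have htanh : Real.tanh a = t * a := (div_mul_cancel₀ _ ha).symm
  have ht0 : 0 ≤ t := by
    have h := mul_tanh_nonneg a
    rw [htanh, mul_left_comm] at h
    exact nonneg_of_mul_nonneg_left h (mul_self_pos.2 ha)
  have ht1 : t ≤ 1 := by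
    refine (le_abs_self t).trans ?_
    rw [ht, abs_div, div_le_one (abs_pos.2 ha)]
    exact abs_tanh_le_abs a
  have hcross : a * -(b - a) ≤ τ * a ^ 2 := by
    calc a * -(b - a) ≤ |a| * |b - a| := by rw [← abs_neg (b - a), ← abs_mul]; exact le_abs_self _
      _ ≤ |a| * (τ * |a|) := by gcongr
      _ = τ * a ^ 2 := by rw [← sq_abs a]; ring
  have hlinear : 2 * l * (1 - 2 * l) * (t * (a * -(b - a))) ≤
      2 * l * (1 - 2 * l) * (t * (τ * a ^ 2)) := by
    have : 0 ≤ 1 - 2 * l := by linarith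
    gcongr
  have hquadratic : 2 * l ^ 2 * (t * (b - a) ^ 2) ≤ 2 * l ^ 2 * (b - a) ^ 2 := by
    gcongr
    exact mul_le_of_le_one_left (sq_nonneg _) ht1
  rw [htanh]
  linear_combination hlinear + hquadratic

theorem three_mul_sq_mul_pow_four_le (hl : l ∈ Set.Icc (0 : ℝ) (1 / 2))
    (hb : |b - a| ≤ 1 / 50 * |a|) :
    3 * l ^ 2 * a ^ 4 ≤ ((a - 2 * l * b) ^ 2 - a ^ 2) ^ 2 := by
  have hb_lower : 49 / 50 * |a| ≤ |b| := by
    linarith [abs_sub_abs_le_abs_sub a b, abs_sub_comm a b]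
  have hb_upper : |b| ≤ 51 / 50 * |a| := by linarith [abs_sub_abs_le_abs_sub b a]
  have hlb : |l * b| ≤ 1 / 2 * |b| := by
    rw [abs_mul, abs_of_nonneg hl.1]
    exact mul_le_mul_of_nonneg_right hl.2 (abs_nonneg b)
  have hab : 49 / 100 * |a| ≤ |a - l * b| := by linarith [abs_sub_abs_le_abs_sub a (l * b)]
  calc 3 * l ^ 2 * a ^ 4 = 3 * (l ^ 2 * |a| ^ 4) := by rw [Even.pow_abs (by decide)]; ring
    _ ≤ 16 * (49 / 50) ^ 2 * (49 / 100) ^ 2 * (l ^ 2 * |a| ^ 4) := by gcongr; norm_num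
    _ = 16 * l ^ 2 * (49 / 50 * |a|) ^ 2 * (49 / 100 * |a|) ^ 2 := by ring
    _ ≤ 16 * l ^ 2 * |b| ^ 2 * |a - l * b| ^ 2 := by gcongr
    _ = ((a - 2 * l * b) ^ 2 - a ^ 2) ^ 2 := by rw [sq_abs, sq_abs]; ring

-- The tilt `l` against a perturbed weight `b` loses at most `2 * (b - a) ^ 2` in second order,
-- and gains the strong-concavity term `a ^ 4`, which pays for that loss on average.
theorem log_cosh_sub_div_cosh_le {M : ℝ} (haM : |a| ≤ M) (hl : l ∈ Set.Icc (0 : ℝ) (1 / 2))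
    (hτ : τ ≤ 1 / 50) (hb : |b - a| ≤ τ * |a|) :
    Real.log (Real.cosh (a - 2 * l * b) / Real.cosh a) ≤
      2 * (a * Real.tanh a) * (l ^ 2 - l + τ * l * (1 - 2 * l)) +
        l ^ 2 * (2 * (b - a) ^ 2 - a ^ 4 / (4 * Real.cosh (3 * M) ^ 2)) := by
  rcases eq_or_ne a 0 with rfl | ha
  · have hb0 : b = 0 := by simpa using hb
    simp [hb0]
  have hb' : |b - a| ≤ 1 / 50 * |a| := hb.trans (by gcongr)
  have hv : |a - 2 * l * b| ≤ 3 * M := by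
    have h1 := abs_sub a (2 * l * b)
    have h2 : |2 * l * b| ≤ 1 * |b| := by
      rw [abs_mul, abs_of_nonneg (by linarith [hl.1])]
      exact mul_le_mul_of_nonneg_right (by linarith [hl.2]) (abs_nonneg b)
    linarith [abs_sub_abs_le_abs_sub b a, abs_nonneg a]
  have htangent := log_cosh_le_tangent_sub_sq ha (by linarith [abs_nonneg a]) hv
  have hlinear := tanh_div_mul_sq_sub_sq_le ha hl hb
  have hgap : l ^ 2 * (a ^ 4 / (4 * Real.cosh (3 * M) ^ 2)) ≤
      1 / (12 * Real.cosh (3 * M) ^ 2) * ((a - 2 * l * b) ^ 2 - a ^ 2) ^ 2 := by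
    calc l ^ 2 * (a ^ 4 / (4 * Real.cosh (3 * M) ^ 2))
        = 1 / (12 * Real.cosh (3 * M) ^ 2) * (3 * l ^ 2 * a ^ 4) := by
          have := (Real.cosh_pos (3 * M)).ne'
          field_simp
          ring
      _ ≤ _ := by gcongr; exact three_mul_sq_mul_pow_four_le hl hb'
  rw [Real.log_div (Real.cosh_pos _).ne' (Real.cosh_pos _).ne']
  linarith

variable {ι : Type*} (s : Finset ι) {a b : ι → ℝ}

theorem prod_cosh_sub_div_cosh_le {M : ℝ} (haM : ∀ i ∈ s, |a i| ≤ M)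
    (hl : l ∈ Set.Icc (0 : ℝ) (1 / 2)) (hτ : τ ≤ 1 / 50) (hb : ∀ i ∈ s, |b i - a i| ≤ τ * |a i|)
    (hsq : 8 * Real.cosh (3 * M) ^ 2 * ∑ i ∈ s, (b i - a i) ^ 2 ≤ ∑ i ∈ s, a i ^ 4) :
    ∏ i ∈ s, (Real.cosh (a i - 2 * l * b i) / Real.cosh (a i)) ≤
      Real.exp (2 * (∑ i ∈ s, a i * Real.tanh (a i)) * (l ^ 2 - l + τ * l * (1 - 2 * l))) := by
  have hpos : ∀ i, 0 < Real.cosh (a i - 2 * l * b i) / Real.cosh (a i) :=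
    fun i => div_pos (Real.cosh_pos _) (Real.cosh_pos _)
  rw [← Real.log_le_iff_le_exp (Finset.prod_pos fun i _ => hpos i),
    Real.log_prod fun i _ => (hpos i).ne']
  have hsum := Finset.sum_le_sum fun i hi => log_cosh_sub_div_cosh_le (haM i hi) hl hτ (hb i hi)
  rw [Finset.sum_add_distrib, ← Finset.sum_mul, ← Finset.mul_sum, ← Finset.mul_sum,
    Finset.sum_sub_distrib, ← Finset.mul_sum, ← Finset.sum_div] at hsum
  have hslack :
      2 * ∑ i ∈ s, (b i - a i) ^ 2 ≤ (∑ i ∈ s, a i ^ 4) / (4 * Real.cosh (3 * M) ^ 2) := by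
    have := Real.cosh_pos (3 * M)
    rw [le_div_iff₀ (by positivity)]
    linarith
  nlinarith [sq_nonneg l]

theorem sq_avg_abs_mul_sum_sq_le {g : ι → ℝ} (hg : ∀ i ∈ s, |g i| ≤ |a i|) :
    ((∑ i ∈ s, |g i|) / s.card) ^ 2 * ∑ i ∈ s, a i ^ 2 ≤ ∑ i ∈ s, a i ^ 4 := by
  rcases s.eq_empty_or_nonempty with rfl | hs
  · simp
  have hcard : (0 : ℝ) < s.card := by exact_mod_cast hs.card_pos
  have hsq : ∑ i ∈ s, |g i| ^ 2 ≤ ∑ i ∈ s, a i ^ 2 := Finset.sum_le_sum fun i hi =>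
    (pow_le_pow_left₀ (abs_nonneg _) (hg i hi) 2).trans_eq (sq_abs _)
  have hsum_abs := (sq_sum_le_card_mul_sum_sq (s := s) (f := fun i => |g i|)).trans
    (mul_le_mul_of_nonneg_left hsq hcard.le)
  have hsum_sq := sq_sum_le_card_mul_sum_sq (s := s) (f := fun i => a i ^ 2)
  simp only [← pow_mul] at hsum_sq
  rw [div_pow]
  calc (∑ i ∈ s, |g i|) ^ 2 / s.card ^ 2 * ∑ i ∈ s, a i ^ 2
      ≤ (s.card * ∑ i ∈ s, a i ^ 2) / s.card ^ 2 * ∑ i ∈ s, a i ^ 2 := by gcongr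
    _ = (∑ i ∈ s, a i ^ 2) ^ 2 / s.card := by field_simp
    _ ≤ ∑ i ∈ s, a i ^ 4 := by
      rw [div_le_iff₀ hcard]
      linarith

theorem sum_sq_le_of_abs_le_mul_add_avg {d g : ι → ℝ} {η : ℝ} (hg : ∀ i ∈ s, |g i| ≤ |a i|)
    (hd : ∀ i ∈ s, |d i| ≤ η * |a i| * (|g i| + (∑ j ∈ s, |g j|) / s.card)) :
    ∑ i ∈ s, d i ^ 2 ≤ 4 * η ^ 2 * ∑ i ∈ s, a i ^ 4 := by
  have havg := sq_avg_abs_mul_sum_sq_le s hg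
  set D := (∑ j ∈ s, |g j|) / s.card
  have hterm : ∀ i ∈ s, d i ^ 2 ≤ 2 * η ^ 2 * a i ^ 4 + 2 * η ^ 2 * D ^ 2 * a i ^ 2 := by
    intro i hi
    have hsq := pow_le_pow_left₀ (abs_nonneg _) (hd i hi) 2
    have hgi := pow_le_pow_left₀ (abs_nonneg _) (hg i hi) 2
    rw [mul_pow, mul_pow, sq_abs, sq_abs] at hsq
    rw [sq_abs (a i)] at hgi
    calc d i ^ 2 ≤ η ^ 2 * a i ^ 2 * (|g i| + D) ^ 2 := hsq
      _ ≤ η ^ 2 * a i ^ 2 * (2 * (a i ^ 2 + D ^ 2)) := by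
        gcongr
        linarith [two_mul_le_add_sq |g i| D, add_sq |g i| D]
      _ = _ := by ring
  have hsum := Finset.sum_le_sum hterm
  rw [Finset.sum_add_distrib, ← Finset.mul_sum, ← Finset.mul_sum] at hsum
  nlinarith [sq_nonneg η]

end Cumulant

section BernoulliTail

theorem bernoulli_mgf_le {q l : ℝ} (hq : 0 ≤ q) (hl : |l| ≤ 1) :
    q * Real.exp (l * (1 - q)) + (1 - q) * Real.exp (l * -q) ≤
      Real.exp (q * (l ^ 2 / 2 + 2 / 9 * |l| ^ 3)) := by
  have hquad : Real.exp l - 1 - l ≤ l ^ 2 / 2 + 2 / 9 * |l| ^ 3 := by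
    have := Real.exp_bound hl (n := 3) (by norm_num)
    norm_num [Finset.sum_range_succ] at this
    linarith [(abs_le.1 this).2]
  calc q * Real.exp (l * (1 - q)) + (1 - q) * Real.exp (l * -q)
      = (q * (Real.exp l - 1) + 1) * Real.exp (-(q * l)) := by
        rw [show l * (1 - q) = l + -(q * l) by ring, show l * -q = -(q * l) by ring, Real.exp_add]
        ring
    _ ≤ Real.exp (q * (Real.exp l - 1)) * Real.exp (-(q * l)) := by
        gcongr
        exact Real.add_one_le_exp _
    _ = Real.exp (q * (Real.exp l - 1 - l)) := by
        rw [← Real.exp_add]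
        ring_nf
    _ ≤ Real.exp (q * (l ^ 2 / 2 + 2 / 9 * |l| ^ 3)) := by gcongr

theorem bernoulli_mgf_le_min {q l : ℝ} (hq : q ∈ Set.Icc (0 : ℝ) 1) (hl : |l| ≤ 1) :
    q * Real.exp (l * (1 - q)) + (1 - q) * Real.exp (l * -q) ≤
      Real.exp (min q (1 - q) * (l ^ 2 / 2 + 2 / 9 * |l| ^ 3)) := by
  rcases le_total q (1 - q) with h | h
  · simpa only [min_eq_left h] using bernoulli_mgf_le hq.1 hl
  · have := bernoulli_mgf_le (sub_nonneg.2 hq.2) (l := -l) (by rwa [abs_neg])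
    rw [abs_neg, neg_sq] at this
    rw [min_eq_right h]
    refine (le_of_eq ?_).trans this
    ring_nf

variable {Ω ι : Type*} [MeasurableSpace Ω] {μ : Measure Ω}

theorem mgf_indicator_one_sub_const [IsProbabilityMeasure μ] {E : Set Ω} (hE : MeasurableSet E)
    (q l : ℝ) : mgf (fun ω => E.indicator 1 ω - q) μ l =
      μ.real E * Real.exp (l * (1 - q)) + (1 - μ.real E) * Real.exp (l * -q) := by
  have hexp : ∀ ω, Real.exp (l * (E.indicator 1 ω - q)) =
      E.indicator (fun _ => Real.exp (l * (1 - q))) ω +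
        Eᶜ.indicator (fun _ => Real.exp (l * -q)) ω := by
    intro ω
    by_cases hω : ω ∈ E <;> simp [hω]
  simp only [mgf, hexp]
  rw [integral_add ((integrable_const _).indicator hE) ((integrable_const _).indicator hE.compl),
    integral_indicator_const _ hE, integral_indicator_const _ hE.compl,
    probReal_compl_eq_one_sub hE, smul_eq_mul, smul_eq_mul]

theorem measureReal_card_mul_le_sum_le {Z : ι → Ω → ℝ} (hind : iIndepFun Z μ)
    (hZ : ∀ i, Measurable (Z i)) (hint : ∀ i l, Integrable (fun ω => Real.exp (l * Z i ω)) μ)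
    {m r : ℝ} (hm : 0 ≤ m) (hr : r ∈ Set.Icc (0 : ℝ) (22 / 25))
    (hmgf : ∀ i l, |l| ≤ 1 → mgf (Z i) μ l ≤ Real.exp (m * (l ^ 2 / 2 + 2 / 9 * |l| ^ 3)))
    (s : Finset ι) :
    μ.real {ω | s.card * (r * m) ≤ ∑ i ∈ s, Z i ω} ≤
      Real.exp (-(s.card * m * (3 / 8 * r ^ 2))) := by
  have := hind.isProbabilityMeasure
  obtain ⟨hr0, hr1⟩ := hr
  have hl : |4 / 5 * r| = 4 / 5 * r := abs_of_nonneg (by positivity)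
  have hprod : mgf (∑ i ∈ s, Z i) μ (4 / 5 * r) ≤
      Real.exp (s.card * (m * ((4 / 5 * r) ^ 2 / 2 + 2 / 9 * (4 / 5 * r) ^ 3))) := by
    rw [hind.mgf_sum hZ, Real.exp_nat_mul, ← Finset.prod_const, ← hl, sq_abs]
    exact Finset.prod_le_prod (fun i _ => mgf_nonneg) fun i _ => by
      simpa only [hl] using hmgf i (4 / 5 * r) (by rw [hl]; linarith)
  have hexponent : -(4 / 5 * r) * (s.card * (r * m)) +
      s.card * (m * ((4 / 5 * r) ^ 2 / 2 + 2 / 9 * (4 / 5 * r) ^ 3)) ≤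
        -(s.card * m * (3 / 8 * r ^ 2)) := by
    have hnonneg : 0 ≤ s.card * m * r ^ 2 := by positivity
    linarith [mul_le_mul_of_nonneg_left hr1 hnonneg]
  calc μ.real {ω | s.card * (r * m) ≤ ∑ i ∈ s, Z i ω}
      ≤ Real.exp (-(4 / 5 * r) * (s.card * (r * m))) * mgf (∑ i ∈ s, Z i) μ (4 / 5 * r) := by
        simpa only [Finset.sum_apply] using measure_ge_le_exp_mul_mgf _
          (by positivity : 0 ≤ 4 / 5 * r) (hind.integrable_exp_mul_sum hZ fun i _ => hint i _)
    _ ≤ Real.exp (-(s.card * m * (3 / 8 * r ^ 2))) := by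
        refine (mul_le_mul_of_nonneg_left hprod (Real.exp_pos _).le).trans ?_
        rwa [← Real.exp_add, Real.exp_le_exp]

theorem measureReal_card_mul_le_abs_sum_le {Z : ι → Ω → ℝ} (hind : iIndepFun Z μ)
    (hZ : ∀ i, Measurable (Z i)) (hint : ∀ i l, Integrable (fun ω => Real.exp (l * Z i ω)) μ)
    {m r : ℝ} (hm : 0 ≤ m) (hr : r ∈ Set.Icc (0 : ℝ) (22 / 25))
    (hmgf : ∀ i l, |l| ≤ 1 → mgf (Z i) μ l ≤ Real.exp (m * (l ^ 2 / 2 + 2 / 9 * |l| ^ 3)))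
    (s : Finset ι) :
    μ.real {ω | s.card * (r * m) ≤ |∑ i ∈ s, Z i ω|} ≤
      2 * Real.exp (-(s.card * m * (3 / 8 * r ^ 2))) := by
  have := hind.isProbabilityMeasure
  have hupper := measureReal_card_mul_le_sum_le hind hZ hint hm hr hmgf s
  have hlower := measureReal_card_mul_le_sum_le (Z := fun i => -Z i)
    (hind.comp (fun _ x => -x) fun _ => measurable_neg) (fun i => (hZ i).neg)
    (fun i l => by simpa using hint i (-l)) hm hr
    (fun i l hl => by simpa [mgf_neg] using hmgf i (-l) (by rwa [abs_neg])) s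
  simp only [Pi.neg_apply, Finset.sum_neg_distrib] at hlower
  simp only [le_abs, Set.ofPred_or]
  linarith [measureReal_union_le (μ := μ) {ω | s.card * (r * m) ≤ ∑ i ∈ s, Z i ω}
    {ω | s.card * (r * m) ≤ -∑ i ∈ s, Z i ω}]

theorem measureReal_mul_min_le_abs_average_sub_le {E : ι → Set Ω} (hE : ∀ i, MeasurableSet (E i))
    (hind : iIndepFun (fun i => (E i).indicator (1 : Ω → ℝ)) μ) {q : ℝ}
    (hq : ∀ i, μ.real (E i) = q) {s : Finset ι} (hs : s.Nonempty) {r : ℝ}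
    (hr : r ∈ Set.Icc (0 : ℝ) (22 / 25)) :
    μ.real {ω | r * min q (1 - q) ≤ |1 / (s.card : ℝ) * ∑ i ∈ s, (E i).indicator 1 ω - q|} ≤
      2 * Real.exp (-(s.card * min q (1 - q) * (3 / 8 * r ^ 2))) := by
  have := hind.isProbabilityMeasure
  have hq01 : q ∈ Set.Icc (0 : ℝ) 1 := by
    rw [← hq hs.choose]
    exact ⟨measureReal_nonneg, measureReal_le_one⟩
  have : (0 : ℝ) < s.card := by exact_mod_cast hs.card_pos
  have hbdd : ∀ i ω, (E i).indicator (1 : Ω → ℝ) ω - q ∈ Set.Icc (-q) (1 - q) := fun i ω => by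
    by_cases hω : ω ∈ E i <;> simp [hω]
  have hmeas : ∀ i, Measurable fun ω => (E i).indicator (1 : Ω → ℝ) ω - q :=
    fun i => (measurable_one.indicator (hE i)).sub_const q
  have htail := measureReal_card_mul_le_abs_sum_le
    (hind.comp (fun _ x => x - q) fun _ => measurable_id.sub_const q) hmeas
    (fun i l => integrable_exp_mul_of_mem_Icc (hmeas i).aemeasurable (.of_forall (hbdd i)))
    (le_min hq01.1 (sub_nonneg.2 hq01.2)) hr
    (fun i l hl => (mgf_indicator_one_sub_const (hE i) q l).trans_le (by
      simpa only [hq] using bernoulli_mgf_le_min hq01 hl)) s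
  refine (measureReal_mono fun ω hω => ?_).trans htail
  have hsum : ∑ i ∈ s, ((E i).indicator 1 ω - q) =
      s.card * (1 / (s.card : ℝ) * ∑ i ∈ s, (E i).indicator 1 ω - q) := by
    rw [Finset.sum_sub_distrib, Finset.sum_const, nsmul_eq_mul]
    field_simp
  rw [Set.mem_ofPred_eq] at hω
  simp only [Set.mem_ofPred_eq, Function.comp_apply, hsum, abs_mul, Nat.abs_cast]
  gcongr

end BernoulliTail

section LogOdds

theorem abs_logOddsWeight_sub_le {x y r : ℝ} (hr : r ∈ Set.Ico (0 : ℝ) 1)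
    (hy : y ∈ Set.Ioo (0 : ℝ) 1) (hxy : |x - y| < r * min y (1 - y)) (w₀ w₁ : ℝ) :
    |logOddsWeight w₀ w₁ x - Real.log (y / (1 - y))| ≤ Real.log ((1 + r) / (1 - r)) := by
  obtain ⟨hr0, hr1⟩ := hr
  obtain ⟨hy0, hy1⟩ := hy
  obtain ⟨hl, hu⟩ := abs_lt.1 hxy
  have hmin : r * min y (1 - y) ≤ r * y ∧ r * min y (1 - y) ≤ r * (1 - y) := by
    constructor <;> gcongr <;> simp
  have hlog : ∀ {u v : ℝ}, 0 < v → (1 - r) * v ≤ u → u ≤ (1 + r) * v →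
      0 < u ∧ Real.log (1 - r) + Real.log v ≤ Real.log u ∧
        Real.log u ≤ Real.log (1 + r) + Real.log v := by
    intro u v hv h1 h2
    have hu : 0 < u := (mul_pos (sub_pos.2 hr1) hv).trans_le h1
    rw [← Real.log_mul (by linarith) hv.ne', ← Real.log_mul (by linarith) hv.ne']
    exact ⟨hu, Real.log_le_log (mul_pos (sub_pos.2 hr1) hv) h1, Real.log_le_log hu h2⟩
  obtain ⟨hx0, hx⟩ := hlog hy0 (by linarith) (by linarith : x ≤ (1 + r) * y)
  obtain ⟨hx1, hx'⟩ := hlog (sub_pos.2 hy1) (by linarith) (by linarith : 1 - x ≤ (1 + r) * (1 - y))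
  rw [logOddsWeight, if_neg hx0.ne', if_neg (sub_pos.1 hx1).ne, Real.log_div hx0.ne' hx1.ne',
    Real.log_div hy0.ne' (sub_pos.2 hy1).ne', Real.log_div (by linarith) (by linarith), abs_le]
  constructor <;> linarith

end LogOdds

section Margin

variable {ι : Type*} [DecidableEq ι] {p : ι → ℝ} {A B : Finset ι} {i j : ι}

/-- The expectation of `f S`, where `S` is the random subset of `A` that contains each `i ∈ A`
independently with probability `p i`. In the applications `S` is the set of correct voters. -/
def subsetExpect (p : ι → ℝ) (A : Finset ι) (f : Finset ι → ℝ) : ℝ :=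
  ∑ S ∈ A.powerset, (∏ i ∈ S, p i) * (∏ i ∈ A \ S, (1 - p i)) * f S

/-- The margin `#S - #(A \ S)` of a vote in which `S ⊆ A` is the set of correct voters. -/
def voteMargin (A S : Finset ι) : ℤ := 2 * S.card - A.card

/-- The probability that a vote of `A` has margin `k`. -/
def marginProb (p : ι → ℝ) (A : Finset ι) (k : ℤ) : ℝ :=
  subsetExpect p A fun S => if voteMargin A S = k then 1 else 0

/-- The expected sign of the margin: the probability that the majority is right minus the
probability that it is wrong. -/
def meanSign (p : ι → ℝ) (A : Finset ι) : ℝ := subsetExpect p A fun S => (voteMargin A S).sign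

/-- The expectation, restricted to the event of a tie, of the opinion of `i`, counted as `1` if
correct and `-1` if not. -/
def tieCorrelation (p : ι → ℝ) (A : Finset ι) (i : ι) : ℝ :=
  subsetExpect p A fun S => if voteMargin A S = 0 then (if i ∈ S then 1 else -1) else 0

theorem subsetExpect_congr {f g : Finset ι → ℝ} (h : ∀ S ⊆ A, f S = g S) :
    subsetExpect p A f = subsetExpect p A g :=
  Finset.sum_congr rfl fun S hS => by rw [h S (Finset.mem_powerset.1 hS)]

theorem subsetExpect_add (p : ι → ℝ) (A : Finset ι) (f g : Finset ι → ℝ) :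
    subsetExpect p A (fun S => f S + g S) = subsetExpect p A f + subsetExpect p A g := by
  simp only [subsetExpect, mul_add, Finset.sum_add_distrib]

theorem subsetExpect_sub (p : ι → ℝ) (A : Finset ι) (f g : Finset ι → ℝ) :
    subsetExpect p A (fun S => f S - g S) = subsetExpect p A f - subsetExpect p A g := by
  simp only [subsetExpect, mul_sub, Finset.sum_sub_distrib]

theorem subsetExpect_const_mul (p : ι → ℝ) (A : Finset ι) (c : ℝ) (f : Finset ι → ℝ) :
    subsetExpect p A (fun S => c * f S) = c * subsetExpect p A f := by
  simp only [subsetExpect, Finset.mul_sum, mul_left_comm]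

theorem subsetExpect_sum {κ : Type*} (p : ι → ℝ) (A : Finset ι) (s : Finset κ)
    (f : κ → Finset ι → ℝ) :
    subsetExpect p A (fun S => ∑ j ∈ s, f j S) = ∑ j ∈ s, subsetExpect p A (f j) := by
  simp only [subsetExpect, Finset.mul_sum]
  exact Finset.sum_comm

theorem subsetExpect_prod (p : ι → ℝ) (A : Finset ι) (u v : ι → ℝ) :
    subsetExpect p A (fun S => (∏ i ∈ S, u i) * ∏ i ∈ A \ S, v i) =
      ∏ i ∈ A, (p i * u i + (1 - p i) * v i) := by
  simp only [subsetExpect, Finset.prod_add, Finset.prod_mul_distrib, mul_mul_mul_comm]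

theorem subsetExpect_const (p : ι → ℝ) (A : Finset ι) (c : ℝ) :
    subsetExpect p A (fun _ => c) = c := by
  have hone : subsetExpect p A (fun _ => 1) = 1 := by
    simpa using subsetExpect_prod p A (fun _ => 1) fun _ => 1
  simpa only [hone, mul_one] using subsetExpect_const_mul p A c fun _ => 1

theorem subsetExpect_mono (hp : ∀ i, p i ∈ Set.Icc (0 : ℝ) 1) {f g : Finset ι → ℝ}
    (h : ∀ S ⊆ A, f S ≤ g S) : subsetExpect p A f ≤ subsetExpect p A g :=
  Finset.sum_le_sum fun S hS => mul_le_mul_of_nonneg_left (h S (Finset.mem_powerset.1 hS))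
    (mul_nonneg (Finset.prod_nonneg fun i _ => (hp i).1)
      (Finset.prod_nonneg fun i _ => sub_nonneg.2 (hp i).2))

theorem subsetExpect_insert (hi : i ∉ A) (f : Finset ι → ℝ) :
    subsetExpect p (insert i A) f =
      p i * subsetExpect p A (fun S => f (insert i S)) + (1 - p i) * subsetExpect p A f := by
  unfold subsetExpect
  rw [Finset.sum_powerset_insert hi, add_comm, Finset.mul_sum, Finset.mul_sum]
  congr 1 <;> refine Finset.sum_congr rfl fun S hS => ?_ <;>
    have hiS : i ∉ S := fun h => hi (Finset.mem_powerset.1 hS h)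
  · rw [Finset.prod_insert hiS, Finset.insert_sdiff_insert, Finset.sdiff_insert_of_notMem hi]
    ring
  · rw [Finset.insert_sdiff_of_notMem _ hiS, Finset.prod_insert (by simp [hi])]
    ring

theorem voteMargin_insert (hi : i ∉ A) (S : Finset ι) :
    voteMargin (insert i A) S = voteMargin A S - 1 := by
  rw [voteMargin, voteMargin, Finset.card_insert_of_notMem hi]
  push_cast
  ring

theorem voteMargin_insert_insert {S : Finset ι} (hi : i ∉ A) (hiS : i ∉ S) :
    voteMargin (insert i A) (insert i S) = voteMargin A S + 1 := by
  rw [voteMargin_insert hi, voteMargin, voteMargin, Finset.card_insert_of_notMem hiS]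
  push_cast
  ring

theorem subsetExpect_voteMargin_insert (hi : i ∉ A) (g : ℤ → ℝ) :
    subsetExpect p (insert i A) (fun S => g (voteMargin (insert i A) S)) =
      p i * subsetExpect p A (fun S => g (voteMargin A S + 1)) +
        (1 - p i) * subsetExpect p A (fun S => g (voteMargin A S - 1)) := by
  rw [subsetExpect_insert hi]
  simp only [voteMargin_insert hi]
  congr 2
  exact subsetExpect_congr fun S hS => by
    rw [← voteMargin_insert hi, voteMargin_insert_insert hi fun h => hi (hS h)]

theorem marginProb_insert (hi : i ∉ A) (k : ℤ) :
    marginProb p (insert i A) k =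
      p i * marginProb p A (k - 1) + (1 - p i) * marginProb p A (k + 1) := by
  simp only [marginProb, subsetExpect_voteMargin_insert hi (fun s => if s = k then 1 else 0),
    sub_eq_iff_eq_add, ← eq_sub_iff_add_eq]

theorem int_sign_eq_ite (k : ℤ) : k.sign = if 0 < k then 1 else if k < 0 then -1 else 0 := by
  rcases lt_trichotomy k 0 with hk | rfl | hk
  · simp [hk, hk.not_gt, Int.sign_eq_neg_one_of_neg hk]
  · rfl
  · simp [hk, Int.sign_eq_one_of_pos hk]

theorem int_sign_add_one (k : ℤ) :
    (k + 1).sign = k.sign + (if k = -1 then 1 else 0) + if k = 0 then 1 else 0 := by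
  simp only [int_sign_eq_ite]
  split_ifs <;> omega

theorem int_sign_sub_one (k : ℤ) :
    (k - 1).sign = k.sign - (if k = 1 then 1 else 0) - if k = 0 then 1 else 0 := by
  simp only [int_sign_eq_ite]
  split_ifs <;> omega

theorem meanSign_insert (hi : i ∉ A) :
    meanSign p (insert i A) = meanSign p A +
      (p i * marginProb p A (-1) - (1 - p i) * marginProb p A 1) +
        (2 * p i - 1) * marginProb p A 0 := by
  simp only [meanSign, marginProb, subsetExpect_voteMargin_insert hi (fun s => (s.sign : ℝ)),
    ← subsetExpect_const_mul, ← subsetExpect_sub, ← subsetExpect_add]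
  refine subsetExpect_congr fun S _ => ?_
  rw [int_sign_add_one, int_sign_sub_one]
  push_cast
  ring

theorem tieCorrelation_insert_self (hi : i ∉ A) :
    tieCorrelation p (insert i A) i =
      p i * marginProb p A (-1) - (1 - p i) * marginProb p A 1 := by
  have hvote : ∀ S ⊆ A, (if voteMargin (insert i A) (insert i S) = 0 then
      (if i ∈ insert i S then (1 : ℝ) else -1) else 0) = if voteMargin A S = -1 then 1 else 0 := by
    intro S hS
    simp [voteMargin_insert_insert hi fun h => hi (hS h), ← eq_neg_iff_add_eq_zero]
  have hvote' : ∀ S ⊆ A, (if voteMargin (insert i A) S = 0 then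
      (if i ∈ S then (1 : ℝ) else -1) else 0) = -1 * if voteMargin A S = 1 then 1 else 0 := by
    intro S hS
    have hiS : i ∉ S := fun h => hi (hS h)
    simp [voteMargin_insert hi, hiS, sub_eq_zero]
  rw [tieCorrelation, subsetExpect_insert hi, subsetExpect_congr hvote, subsetExpect_congr hvote',
    subsetExpect_const_mul, marginProb, marginProb]
  ring

theorem tieCorrelation_sub_tieCorrelation (hij : i ≠ j) (hi : i ∉ B) (hj : j ∉ B) :
    tieCorrelation p (insert i (insert j B)) i - tieCorrelation p (insert i (insert j B)) j =
      2 * (p i - p j) * marginProb p B 0 := by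
  have hi' : i ∉ insert j B := by simp [hij, hi]
  have hj' : j ∉ insert i B := by simp [hij.symm, hj]
  rw [tieCorrelation_insert_self hi', Finset.insert_comm, tieCorrelation_insert_self hj']
  simp only [marginProb_insert hi, marginProb_insert hj]
  norm_num
  ring

theorem sum_ite_mem_one_neg_one {S : Finset ι} (hS : S ⊆ A) :
    ∑ i ∈ A, (if i ∈ S then (1 : ℝ) else -1) = voteMargin A S := by
  have hite : ∀ i, (if i ∈ S then (1 : ℝ) else -1) = 2 * (if i ∈ S then 1 else 0) - 1 := fun i => by
    split_ifs <;> norm_num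
  simp only [hite, Finset.sum_sub_distrib, ← Finset.mul_sum, Finset.sum_ite_mem,
    Finset.inter_eq_right.2 hS, voteMargin]
  simp

theorem sum_tieCorrelation (p : ι → ℝ) (A : Finset ι) : ∑ i ∈ A, tieCorrelation p A i = 0 := by
  simp only [tieCorrelation]
  rw [← subsetExpect_sum]
  refine (subsetExpect_congr fun S hS => ?_).trans (subsetExpect_const p A 0)
  split_ifs with h
  · rw [sum_ite_mem_one_neg_one hS, h, Int.cast_zero]
  · exact Finset.sum_const_zero

theorem marginProb_nonneg (hp : ∀ i, p i ∈ Set.Icc (0 : ℝ) 1) (A : Finset ι) (k : ℤ) :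
    0 ≤ marginProb p A k := by
  rw [← subsetExpect_const p A 0]
  exact subsetExpect_mono hp fun S _ => by split_ifs <;> norm_num

theorem meanSign_le_one (hp : ∀ i, p i ∈ Set.Icc (0 : ℝ) 1) (A : Finset ι) :
    meanSign p A ≤ 1 := by
  rw [← subsetExpect_const p A 1]
  refine subsetExpect_mono hp fun S _ => ?_
  rw [int_sign_eq_ite]
  split_ifs <;> norm_num

theorem marginProb_le_of_neg (hp : ∀ i, p i ∈ Set.Icc (0 : ℝ) 1) (A : Finset ι) {k : ℤ}
    (hk : k < 0) : marginProb p A k ≤ (1 - meanSign p A) / 2 := by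
  have hexp : (1 - meanSign p A) / 2 =
      subsetExpect p A fun S => 1 / 2 + -1 / 2 * ((voteMargin A S).sign : ℝ) := by
    rw [subsetExpect_add, subsetExpect_const_mul, subsetExpect_const, meanSign]
    ring
  rw [hexp]
  refine subsetExpect_mono hp fun S _ => ?_
  rw [int_sign_eq_ite]
  split_ifs <;> first | omega | norm_num

theorem one_sub_mul_marginProb_le (hp : ∀ i, p i ∈ Set.Icc (0 : ℝ) 1) (hi : i ∉ A) (k : ℤ) :
    (1 - p i) * marginProb p A k ≤ marginProb p (insert i A) (k - 1) := by
  rw [marginProb_insert hi, sub_add_cancel]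
  exact le_add_of_nonneg_left (mul_nonneg (hp i).1 (marginProb_nonneg hp A _))

section Balanced

variable {γ : ℝ}

theorem mul_marginProb_erase_zero_le (hp : ∀ i, p i ∈ Set.Icc (0 : ℝ) 1)
    (hpγ : ∀ i, p i ≤ 1 - γ) (hi : i ∈ A) :
    γ * marginProb p (A.erase i) 0 ≤ (1 - meanSign p A) / 2 := by
  have hstep := one_sub_mul_marginProb_le hp (Finset.notMem_erase i A) 0
  rw [Finset.insert_erase hi] at hstep
  calc γ * marginProb p (A.erase i) 0 ≤ (1 - p i) * marginProb p (A.erase i) 0 :=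
        mul_le_mul_of_nonneg_right (by linarith [hpγ i]) (marginProb_nonneg hp _ _)
    _ ≤ (1 - meanSign p A) / 2 := hstep.trans (marginProb_le_of_neg hp A (by norm_num))

theorem sq_mul_marginProb_zero_le (hp : ∀ i, p i ∈ Set.Icc (0 : ℝ) 1) (hγ : 0 ≤ γ)
    (hpγ : ∀ i, p i ≤ 1 - γ) (hij : i ≠ j) (hi : i ∉ B) (hj : j ∉ B) :
    γ ^ 2 * marginProb p B 0 ≤ (1 - meanSign p (insert i (insert j B))) / 2 := by
  have hone : ∀ l, γ ≤ 1 - p l := fun l => by linarith [hpγ l]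
  have hi' : i ∉ insert j B := by simp [hij, hi]
  calc γ ^ 2 * marginProb p B 0 ≤ (1 - p i) * ((1 - p j) * marginProb p B 0) := by
        rw [sq, ← mul_assoc]
        exact mul_le_mul_of_nonneg_right
          (mul_le_mul (hone i) (hone j) hγ (hγ.trans (hone i))) (marginProb_nonneg hp _ _)
    _ ≤ (1 - p i) * marginProb p (insert j B) (-1) :=
        mul_le_mul_of_nonneg_left (one_sub_mul_marginProb_le hp hj 0) (hγ.trans (hone i))
    _ ≤ marginProb p (insert i (insert j B)) (-2) := one_sub_mul_marginProb_le hp hi' (-1)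
    _ ≤ _ := marginProb_le_of_neg hp _ (by norm_num)

theorem abs_tieCorrelation_sub_le (hp : ∀ i, p i ∈ Set.Icc (0 : ℝ) 1) (hγ : 0 < γ)
    (hpγ : ∀ i, p i ≤ 1 - γ) (hi : i ∈ A) (hj : j ∈ A) :
    |tieCorrelation p A i - tieCorrelation p A j| ≤
      (1 - meanSign p A) / (2 * γ ^ 2) * (|2 * p i - 1| + |2 * p j - 1|) := by
  have hloss : 0 ≤ (1 - meanSign p A) / (2 * γ ^ 2) :=
    div_nonneg (sub_nonneg.2 (meanSign_le_one hp A)) (by positivity)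
  rcases eq_or_ne i j with rfl | hij
  · rw [sub_self, abs_zero]
    positivity
  have hA : insert i (insert j ((A.erase i).erase j)) = A := by
    rw [Finset.insert_erase (Finset.mem_erase.2 ⟨hij.symm, hj⟩), Finset.insert_erase hi]
  have hiB : i ∉ (A.erase i).erase j := by simp
  have hjB : j ∉ (A.erase i).erase j := by simp
  have hdiff := tieCorrelation_sub_tieCorrelation (p := p) hij hiB hjB
  have hprob := sq_mul_marginProb_zero_le hp hγ.le hpγ hij hiB hjB
  rw [hA] at hdiff hprob
  rw [hdiff, abs_mul, abs_of_nonneg (marginProb_nonneg hp _ _), mul_comm]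
  refine mul_le_mul ?_ ?_ (abs_nonneg _) hloss
  · rw [le_div_iff₀ (by positivity)]
    linarith
  · rw [show 2 * (p i - p j) = (2 * p i - 1) - (2 * p j - 1) by ring]
    exact abs_sub _ _

/-- As the correlations with a tie sum to zero, each of them is the average of its differences to
the others. -/
theorem abs_tieCorrelation_le (hp : ∀ i, p i ∈ Set.Icc (0 : ℝ) 1) (hγ : 0 < γ)
    (hpγ : ∀ i, p i ≤ 1 - γ) (hi : i ∈ A) :
    |tieCorrelation p A i| ≤ (1 - meanSign p A) / (2 * γ ^ 2) *
      (|2 * p i - 1| + (∑ j ∈ A, |2 * p j - 1|) / A.card) := by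
  have hcard : (0 : ℝ) < A.card := by exact_mod_cast Finset.card_pos.2 ⟨i, hi⟩
  have havg : A.card * tieCorrelation p A i =
      ∑ j ∈ A, (tieCorrelation p A i - tieCorrelation p A j) := by
    simp [Finset.sum_sub_distrib, sum_tieCorrelation]
  refine le_of_mul_le_mul_left ?_ hcard
  calc A.card * |tieCorrelation p A i|
      = |∑ j ∈ A, (tieCorrelation p A i - tieCorrelation p A j)| := by
        rw [← havg, abs_mul, Nat.abs_cast]
    _ ≤ ∑ j ∈ A, (1 - meanSign p A) / (2 * γ ^ 2) * (|2 * p i - 1| + |2 * p j - 1|) :=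
        (Finset.abs_sum_le_sum_abs _ _).trans
          (Finset.sum_le_sum fun j hj => abs_tieCorrelation_sub_le hp hγ hpγ hi hj)
    _ = A.card * ((1 - meanSign p A) / (2 * γ ^ 2) *
          (|2 * p i - 1| + (∑ j ∈ A, |2 * p j - 1|) / A.card)) := by
        rw [← Finset.mul_sum, Finset.sum_add_distrib, Finset.sum_const, nsmul_eq_mul]
        field_simp

theorem abs_meanSign_erase_sub_le (hp : ∀ i, p i ∈ Set.Icc (0 : ℝ) 1) (hγ : 0 < γ)
    (hpγ : ∀ i, p i ≤ 1 - γ) (hi : i ∈ A) :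
    |meanSign p (A.erase i) - meanSign p A| ≤ (1 - meanSign p A) / γ ^ 2 *
      (|2 * p i - 1| + (∑ j ∈ A, |2 * p j - 1|) / A.card) := by
  have hγ1 : γ ≤ 1 := by linarith [(hp i).1, hpγ i]
  have hprob : marginProb p (A.erase i) 0 ≤ (1 - meanSign p A) / (2 * γ ^ 2) := by
    have hnonneg := marginProb_nonneg hp (A.erase i) 0
    have hsq : γ ^ 2 ≤ γ := pow_le_of_le_one hγ.le hγ1 two_ne_zero
    rw [le_div_iff₀ (by positivity)]
    linarith [mul_marginProb_erase_zero_le hp hpγ hi, mul_le_mul_of_nonneg_right hsq hnonneg]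
  have hbias : |(2 * p i - 1) * marginProb p (A.erase i) 0| ≤
      (1 - meanSign p A) / (2 * γ ^ 2) * |2 * p i - 1| := by
    rw [abs_mul, abs_of_nonneg (marginProb_nonneg hp _ _), mul_comm]
    exact mul_le_mul_of_nonneg_right hprob (abs_nonneg _)
  have hloss : 0 ≤ (1 - meanSign p A) / (2 * γ ^ 2) :=
    div_nonneg (sub_nonneg.2 (meanSign_le_one hp A)) (by positivity)
  have hdiff : meanSign p A - meanSign p (A.erase i) =
      tieCorrelation p A i + (2 * p i - 1) * marginProb p (A.erase i) 0 := by
    have hinsert := meanSign_insert (p := p) (Finset.notMem_erase i A)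
    rw [← tieCorrelation_insert_self (Finset.notMem_erase i A), Finset.insert_erase hi] at hinsert
    linarith
  rw [abs_sub_comm, hdiff]
  have havg : 0 ≤ (1 - meanSign p A) / (2 * γ ^ 2) * ((∑ j ∈ A, |2 * p j - 1|) / A.card) := by
    positivity
  calc _ ≤ |tieCorrelation p A i| + |(2 * p i - 1) * marginProb p (A.erase i) 0| := abs_add_le _ _
    _ ≤ 2 * ((1 - meanSign p A) / (2 * γ ^ 2)) *
          (|2 * p i - 1| + (∑ j ∈ A, |2 * p j - 1|) / A.card) := by
        linarith [abs_tieCorrelation_le hp hγ hpγ hi]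
    _ = _ := by field_simp

end Balanced

end Margin

section RandomSubset

variable {Ω ι : Type*} [DecidableEq ι] {E : ι → Set Ω} {A : Finset ι} {Z : Ω → Finset ι}

theorem setOf_eq_biInter_ite (hZ : ∀ ω i, i ∈ Z ω ↔ i ∈ A ∧ ω ∈ E i) {S : Finset ι} (hS : S ⊆ A) :
    {ω | Z ω = S} = ⋂ i ∈ A, if i ∈ S then E i else (E i)ᶜ := by
  ext ω
  simp only [Set.mem_iInter, Set.mem_ofPred_eq, Finset.ext_iff, hZ]
  refine ⟨fun h i hi => ?_, fun h i => ⟨fun ⟨hi, hω⟩ => ?_, fun hi => ⟨hS hi, ?_⟩⟩⟩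
  · split_ifs with hiS
    · exact ((h i).2 hiS).2
    · exact fun hω => hiS ((h i).1 ⟨hi, hω⟩)
  · by_contra hiS
    simpa only [if_neg hiS, Set.mem_compl_iff, hω, not_true] using h i hi
  · simpa only [if_pos hi] using h i (hS hi)

variable [MeasurableSpace Ω] {μ : Measure Ω}

theorem measureReal_setOf_randomSubset_eq (hind : iIndepSet E μ) (hE : ∀ i, MeasurableSet (E i))
    (hZ : ∀ ω i, i ∈ Z ω ↔ i ∈ A ∧ ω ∈ E i) {S : Finset ι} (hS : S ⊆ A) :
    μ.real {ω | Z ω = S} = (∏ i ∈ S, μ.real (E i)) * ∏ i ∈ A \ S, (1 - μ.real (E i)) := by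
  have := iIndep.isProbabilityMeasure hind
  have hprod : μ.real {ω | Z ω = S} = ∏ i ∈ A, μ.real (if i ∈ S then E i else (E i)ᶜ) := by
    rw [setOf_eq_biInter_ite hZ hS, measureReal_def, iIndep.meas_biInter hind fun i _ => ?_,
      ENNReal.toReal_prod]
    · rfl
    · have := MeasurableSpace.measurableSet_generateFrom (Set.mem_singleton (E i))
      split_ifs
      exacts [this, this.compl]
  rw [hprod, ← Finset.prod_sdiff hS, mul_comm]
  congr 1 <;> refine Finset.prod_congr rfl fun i hi => ?_
  · rw [if_pos hi]
  · rw [if_neg (Finset.mem_sdiff.1 hi).2, probReal_compl_eq_one_sub (hE i)]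

theorem measureReal_setOf_randomSubset (hind : iIndepSet E μ) (hE : ∀ i, MeasurableSet (E i))
    (hZ : ∀ ω i, i ∈ Z ω ↔ i ∈ A ∧ ω ∈ E i) (Q : Finset ι → Prop) [DecidablePred Q] :
    μ.real {ω | Q (Z ω)} =
      subsetExpect (fun i => μ.real (E i)) A fun S => if Q S then 1 else 0 := by
  have := iIndep.isProbabilityMeasure hind
  have hunion : {ω | Q (Z ω)} = ⋃ S ∈ A.powerset.filter Q, {ω | Z ω = S} := by
    ext ω
    have hsub : Z ω ⊆ A := fun i hi => ((hZ ω i).1 hi).1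
    simp [hsub]
  rw [hunion, measureReal_biUnion_finset]
  · rw [Finset.sum_filter, subsetExpect]
    refine Finset.sum_congr rfl fun S hS => ?_
    rw [measureReal_setOf_randomSubset_eq hind hE hZ (Finset.mem_powerset.1 hS), mul_ite,
      mul_one, mul_zero]
  · exact fun S _ S' _ hne => Set.disjoint_left.2 fun ω hω hω' => hne (hω.symm.trans hω')
  · intro S hS
    rw [setOf_eq_biInter_ite hZ (Finset.mem_powerset.1 (Finset.mem_filter.1 hS).1)]
    refine Finset.measurableSet_biInter _ fun i _ => ?_
    split_ifs
    exacts [hE i, (hE i).compl]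

end RandomSubset

section MajorityVote

variable {ι : Type*} {p : ι → ℝ} {A B : Finset ι} {x : ι → ℝ} {i : ι} {y : ℝ}

/-- The members of `A` whose opinion is the state `y`. -/
noncomputable def correctVoters (A : Finset ι) (x : ι → ℝ) (y : ℝ) : Finset ι :=
  A.filter fun i => x i = y

theorem mem_correctVoters : i ∈ correctVoters A x y ↔ i ∈ A ∧ x i = y := Finset.mem_filter

theorem sum_mul_mul_le_add_of_abs_sub_le (hx : ∀ i, x i = 1 ∨ x i = -1) (hy : y = 1 ∨ y = -1)
    {u v : ι → ℝ} {κ : ℝ} (huv : ∀ i ∈ A, |u i - v i| ≤ κ) :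
    (∑ i ∈ A, x i * v i) * y ≤ (∑ i ∈ A, x i * u i) * y + A.card * κ := by
  have hterm : ∀ i ∈ A, x i * v i * y ≤ x i * u i * y + κ := by
    intro i hi
    obtain ⟨hlow, hup⟩ := abs_le.1 (huv i hi)
    rcases hx i with h | h <;> rcases hy with rfl | rfl <;> rw [h] <;> linarith
  rw [Finset.sum_mul, Finset.sum_mul, ← nsmul_eq_mul, ← Finset.sum_const, ← Finset.sum_add_distrib]
  exact Finset.sum_le_sum hterm

theorem sum_mul_eq_sum_correctVoters [DecidableEq ι] (hx : ∀ i, x i = 1 ∨ x i = -1)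
    (hy : y = 1 ∨ y = -1) (A : Finset ι) (w : ι → ℝ) :
    (∑ i ∈ A, x i * w i) * y =
      ∑ i ∈ correctVoters A x y, w i + ∑ i ∈ A \ correctVoters A x y, -w i := by
  have hterm : ∀ i, x i * w i * y = if x i = y then w i else -w i := by
    intro i
    rcases hx i with h | h <;> rcases hy with rfl | rfl <;> norm_num [h]
  rw [Finset.sum_mul, Finset.sum_congr rfl fun i _ => hterm i, Finset.sum_ite, Finset.filter_not,
    correctVoters]

theorem sum_mul_eq_voteMargin (hx : ∀ i, x i = 1 ∨ x i = -1) (hy : y = 1 ∨ y = -1)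
    (A : Finset ι) : (∑ i ∈ A, x i) * y = voteMargin A (correctVoters A x y) := by
  classical
  have hsum := sum_mul_eq_sum_correctVoters hx hy A fun _ => 1
  have hsub : correctVoters A x y ⊆ A := Finset.filter_subset _ _
  simp only [mul_one, Finset.sum_const, nsmul_eq_mul, mul_neg, Finset.card_sdiff_of_subset hsub,
    Nat.cast_sub (Finset.card_le_card hsub)] at hsum
  rw [hsum, voteMargin]
  push_cast
  ring

theorem signWithTie_eq_iff (hy : y = 1 ∨ y = -1) (tie s : ℝ) :
    signWithTie tie s = y ↔ 0 < s * y ∨ s * y = 0 ∧ tie = y := by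
  rw [signWithTie]
  rcases hy with rfl | rfl <;> rcases lt_trichotomy s 0 with hs | rfl | hs <;>
    norm_num [*, le_of_lt, ne_of_lt, ne_of_gt]

theorem mul_nonpos_of_signWithTie_ne (hy : y = 1 ∨ y = -1) {tie s : ℝ}
    (hne : signWithTie tie s ≠ y) : s * y ≤ 0 :=
  not_lt.1 fun hs => hne ((signWithTie_eq_iff hy tie s).2 (Or.inl hs))

/-- The condition, in terms of its margin `k`, for a vote with tie-breaking value `tie` to find the
state `y`. -/
def MajorityCorrect (tie y : ℝ) (k : ℤ) : Prop := 0 < k ∨ k = 0 ∧ tie = y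

noncomputable instance (tie y : ℝ) : DecidablePred (MajorityCorrect tie y) :=
  fun _ => inferInstanceAs (Decidable (_ ∨ _))

theorem majorityVote_eq_iff {x : ℕ → ℝ} (hx : ∀ i, x i = 1 ∨ x i = -1) (hy : y = 1 ∨ y = -1)
    (tie : Finset ℕ → ℝ) (A : Finset ℕ) :
    majorityVote tie A x = y ↔
      MajorityCorrect (tie A) y (voteMargin A (correctVoters A x y)) := by
  rw [majorityVote, signWithTie_eq_iff hy, sum_mul_eq_voteMargin hx hy, MajorityCorrect]
  norm_cast

variable [DecidableEq ι]

theorem erase_correctVoters_insert (hi : i ∉ B) :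
    (correctVoters (insert i B) x y).erase i = correctVoters B x y := by
  rw [correctVoters, ← Finset.filter_erase, Finset.erase_insert hi, correctVoters]

theorem subsetExpect_majorityCorrect_add {tie : ℝ} (htie : tie = 1 ∨ tie = -1) (p : ι → ℝ)
    (A : Finset ι) :
    subsetExpect p A (fun S => if MajorityCorrect tie 1 (voteMargin A S) then 1 else 0) +
      subsetExpect p A (fun S => if MajorityCorrect tie (-1) (voteMargin A S) then 1 else 0) =
        1 + meanSign p A := by
  rw [meanSign, ← subsetExpect_add]
  conv_rhs => rw [← subsetExpect_const p A 1, ← subsetExpect_add]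
  refine subsetExpect_congr fun S _ => ?_
  rcases lt_trichotomy (voteMargin A S) 0 with h | h | h
  · simp [MajorityCorrect, h.not_gt, h.ne, Int.sign_eq_neg_one_of_neg h]
  · rcases htie with rfl | rfl <;> norm_num [MajorityCorrect, h]
  · simp [MajorityCorrect, h, Int.sign_eq_one_of_pos h]

theorem subsetExpect_insert_mem_iff (hi : i ∉ B) (R : Finset ι → Prop) [DecidablePred R] :
    subsetExpect p (insert i B) (fun S => if (i ∈ S ↔ R (S.erase i)) then 1 else 0) =
      p i * subsetExpect p B (fun S => if R S then 1 else 0) +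
        (1 - p i) * (1 - subsetExpect p B (fun S => if R S then 1 else 0)) := by
  have hcompl : 1 - subsetExpect p B (fun S => if R S then 1 else 0) =
      subsetExpect p B fun S => 1 - if R S then 1 else 0 := by
    rw [subsetExpect_sub, subsetExpect_const]
  rw [subsetExpect_insert hi, hcompl]
  congr 2 <;> refine subsetExpect_congr fun S hS => ?_ <;>
    have hiS : i ∉ S := fun h => hi (hS h)
  · simp [Finset.erase_insert hiS]
  · by_cases hR : R S <;> simp [hiS, hR]

theorem subsetExpect_sum_le_le_exp_mul_prod (hp : ∀ i, p i ∈ Set.Icc (0 : ℝ) 1) (A : Finset ι)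
    (w : ι → ℝ) (K : ℝ) {l : ℝ} (hl : 0 ≤ l) :
    subsetExpect p A (fun S => if ∑ i ∈ S, w i + ∑ i ∈ A \ S, -w i ≤ K then 1 else 0) ≤
      Real.exp (l * K) *
        ∏ i ∈ A, (p i * Real.exp (-(l * w i)) + (1 - p i) * Real.exp (l * w i)) := by
  rw [← subsetExpect_prod, ← subsetExpect_const_mul]
  refine subsetExpect_mono hp fun S _ => ?_
  rw [← Real.exp_sum, ← Real.exp_sum, ← Real.exp_add, ← Real.exp_add]
  split_ifs with hK
  · have hexponent := mul_le_mul_of_nonneg_left hK hl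
    simp only [mul_add, Finset.mul_sum, mul_neg, Finset.sum_neg_distrib] at hexponent ⊢
    exact Real.one_le_exp (by linarith)
  · exact (Real.exp_pos _).le

end MajorityVote

section OpinionModel

variable {Ω : Type*}

/-- The probability that expert `i` agrees with the majority vote of the other `N - 1` members. -/
noncomputable def pseudoCompetence (p : ℕ → ℝ) (N i : ℕ) : ℝ :=
  1 / 2 + (p i - 1 / 2) * meanSign p ((Finset.range N).erase i)

theorem pseudoCompetence_mem_Ioo {p : ℕ → ℝ} {N i : ℕ} {γ : ℝ} (hp : p i ∈ Set.Ioo γ (1 - γ))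
    (hc : meanSign p ((Finset.range N).erase i) ∈ Set.Ioc 0 1) :
    pseudoCompetence p N i ∈ Set.Ioo γ (1 - γ) := by
  obtain ⟨hc0, hc1⟩ := hc
  obtain ⟨hpl, hpu⟩ := hp
  rw [pseudoCompetence]
  constructor <;> nlinarith

theorem majorityVote_eq_one_or {tie : Finset ℕ → ℝ} {A : Finset ℕ}
    (htie : tie A = 1 ∨ tie A = -1) (x : ℕ → ℝ) :
    majorityVote tie A x = 1 ∨ majorityVote tie A x = -1 := by
  rw [majorityVote, signWithTie]
  split_ifs
  exacts [Or.inl rfl, Or.inr rfl, htie]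

theorem empiricalPseudoCompetence_eq (X : ℕ → ℕ → Ω → ℝ) (tie : ℕ → Finset ℕ → ℝ)
    (N T i : ℕ) (ω : Ω) :
    empiricalPseudoCompetence X tie N T i ω = 1 / ((Finset.range T).card : ℝ) *
      ∑ t ∈ Finset.range T, {ω | X i t ω =
        majorityVote (tie t) ((Finset.range N).erase i) fun j => X j t ω}.indicator 1 ω := by
  simp only [empiricalPseudoCompetence, Finset.card_range, Set.indicator_apply, Set.mem_ofPred_eq,
    Pi.one_apply]

variable [MeasurableSpace Ω] {μ : Measure Ω} {p : ℕ → ℝ} {Y : ℕ → Ω → ℝ} {X : ℕ → ℕ → Ω → ℝ}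

theorem measurable_signWithTie (tie : ℝ) : Measurable (signWithTie tie) :=
  Measurable.ite measurableSet_Ioi measurable_const
    (Measurable.ite measurableSet_Iio measurable_const measurable_const)

theorem measurable_majorityVote {x : ℕ → Ω → ℝ} (hx : ∀ i, Measurable (x i)) (tie : Finset ℕ → ℝ)
    (A : Finset ℕ) : Measurable fun ω => majorityVote tie A fun i => x i ω :=
  (measurable_signWithTie _).comp (Finset.measurable_sum _ fun i _ => hx i)

namespace IsOpinionModel

theorem measurableSet_state_eq (h : IsOpinionModel μ p Y X) (t : ℕ) (y : ℝ) :
    MeasurableSet {ω | Y t ω = y} :=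
  h.measurable_state t (measurableSet_singleton y)

theorem measurableSet_opinion_eq_majorityVote (h : IsOpinionModel μ p Y X) (tie : Finset ℕ → ℝ)
    (B : Finset ℕ) (i t : ℕ) :
    MeasurableSet {ω | X i t ω = majorityVote tie B fun j => X j t ω} :=
  measurableSet_eq_fun (h.measurable_opinion i t)
    (measurable_majorityVote (fun j => h.measurable_opinion j t) tie B)

theorem cond_real_correctVoters (h : IsOpinionModel μ p Y X) (t : ℕ) (A : Finset ℕ) {y : ℝ}
    (hy : y = 1 ∨ y = -1) (Q : Finset ℕ → Prop) [DecidablePred Q] :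
    (μ[|{ω | Y t ω = y}]).real {ω | Q (correctVoters A (fun i => X i t ω) y)} =
      subsetExpect p A fun S => if Q S then 1 else 0 := by
  have hE : ∀ i, MeasurableSet {ω | X i t ω = y} :=
    fun i => h.measurable_opinion i t (measurableSet_singleton y)
  have hind : iIndepSet (fun i => {ω | X i t ω = y}) (μ[|{ω | Y t ω = y}]) :=
    (iIndepSet_iff_meas_biInter hE).2 fun s =>
      (h.opinions_condIndep t y hy).measure_inter_preimage_eq_mul s (sets := fun _ => {y})
        fun _ _ => measurableSet_singleton y
  rw [measureReal_setOf_randomSubset hind hE (fun _ _ => mem_correctVoters) Q]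
  simp only [h.competence _ t y hy]

theorem real_eq_half_mul_add (h : IsOpinionModel μ p Y X) (t : ℕ) (A : Finset ℕ) {E : Ω → Prop}
    (Q : ℝ → Finset ℕ → Prop) [∀ y, DecidablePred (Q y)]
    (hQ : ∀ ω, E ω ↔ Q (Y t ω) (correctVoters A (fun i => X i t ω) (Y t ω))) :
    μ.real {ω | E ω} = 1 / 2 * (subsetExpect p A (fun S => if Q 1 S then 1 else 0) +
      subsetExpect p A fun S => if Q (-1) S then 1 else 0) := by
  have := h.tasks_indep.isProbabilityMeasure
  have hpart : ∀ y : ℝ, y = 1 ∨ y = -1 → μ.real ({ω | Y t ω = y} ∩ {ω | E ω}) =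
      1 / 2 * subsetExpect p A fun S => if Q y S then 1 else 0 := by
    intro y hy
    have hset : {ω | Y t ω = y} ∩ {ω | E ω} =
        {ω | Y t ω = y} ∩ {ω | Q y (correctVoters A (fun i => X i t ω) y)} := by
      ext ω
      exact and_congr_right fun hω => by rw [Set.mem_ofPred_eq, hQ, hω, Set.mem_ofPred_eq]
    rw [← h.cond_real_correctVoters t A hy, ← h.uniform_prior t y hy, hset, mul_comm]
    simp only [measureReal_def, ← ENNReal.toReal_mul,
      cond_mul_eq_inter (h.measurableSet_state_eq t y)]
  have hcompl : {ω | E ω} \ {ω | Y t ω = 1} = {ω | Y t ω = -1} ∩ {ω | E ω} := by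
    ext ω
    rcases h.state_values t ω with hω | hω <;> norm_num [hω]
  rw [← measureReal_inter_add_sdiff (s := {ω | E ω}) (h.measurableSet_state_eq t 1), hcompl,
    Set.inter_comm {ω | E ω},
    hpart 1 (Or.inl rfl), hpart (-1) (Or.inr rfl), mul_add]

theorem majorityAccuracy_eq (h : IsOpinionModel μ p Y X) {tie : ℕ → Finset ℕ → ℝ}
    (htie : ∀ t A, tie t A = 1 ∨ tie t A = -1) (n : ℕ) :
    majorityAccuracy μ Y X tie n = (1 + meanSign p (Finset.range n)) / 2 := by
  rw [majorityAccuracy, h.real_eq_half_mul_add 0 (Finset.range n)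
    (fun y S => MajorityCorrect (tie 0 (Finset.range n)) y (voteMargin (Finset.range n) S))
    fun ω => majorityVote_eq_iff (fun i => h.opinion_values i 0 ω) (h.state_values 0 ω) _ _,
    subsetExpect_majorityCorrect_add (htie 0 _)]
  ring

theorem real_agreement_eq (h : IsOpinionModel μ p Y X) {tie : Finset ℕ → ℝ} {B : Finset ℕ}
    (htie : tie B = 1 ∨ tie B = -1) {i : ℕ} (hi : i ∉ B) (t : ℕ) :
    μ.real {ω | X i t ω = majorityVote tie B fun j => X j t ω} =
      1 / 2 + (p i - 1 / 2) * meanSign p B := by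
  rw [h.real_eq_half_mul_add t (insert i B)
    fun y S => i ∈ S ↔ MajorityCorrect (tie B) y (voteMargin B (S.erase i))]
  · rw [subsetExpect_insert_mem_iff hi fun S => MajorityCorrect (tie B) 1 (voteMargin B S),
      subsetExpect_insert_mem_iff hi fun S => MajorityCorrect (tie B) (-1) (voteMargin B S)]
    linear_combination (p i - 1 / 2) * subsetExpect_majorityCorrect_add htie p B
  · intro ω
    have hX := fun j => h.opinion_values j t ω
    rw [erase_correctVoters_insert hi, ← majorityVote_eq_iff hX (h.state_values t ω),
      mem_correctVoters, and_iff_right (Finset.mem_insert_self i B)]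
    rcases majorityVote_eq_one_or htie fun j => X j t ω with hV | hV <;>
      rcases hX i with hXi | hXi <;> rcases h.state_values t ω with hY | hY <;>
      norm_num [hV, hXi, hY]

theorem real_sum_mul_state_le (h : IsOpinionModel μ p Y X) (hp : ∀ i, p i ∈ Set.Icc (0 : ℝ) 1)
    (A : Finset ℕ) (w : ℕ → ℝ) (K : ℝ) {l : ℝ} (hl : 0 ≤ l) (t : ℕ) :
    μ.real {ω | (∑ i ∈ A, X i t ω * w i) * Y t ω ≤ K} ≤ Real.exp (l * K) *
      ∏ i ∈ A, (p i * Real.exp (-(l * w i)) + (1 - p i) * Real.exp (l * w i)) := by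
  rw [h.real_eq_half_mul_add t A (fun _ S => ∑ i ∈ S, w i + ∑ i ∈ A \ S, -w i ≤ K) fun ω => by
    rw [sum_mul_eq_sum_correctVoters (fun i => h.opinion_values i t ω)
      (h.state_values t ω)]]
  linarith [subsetExpect_sum_le_le_exp_mul_prod hp A w K hl]

theorem iIndepFun_indicator_agreement (h : IsOpinionModel μ p Y X) (tie : ℕ → Finset ℕ → ℝ)
    (B : Finset ℕ) (i : ℕ) :
    iIndepFun (fun t => {ω | X i t ω = majorityVote (tie t) B fun j => X j t ω}.indicator
      (1 : Ω → ℝ)) μ := by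
  have hmeas : ∀ t, Measurable ({z : ℝ × (ℕ → ℝ) | z.2 i = majorityVote (tie t) B z.2}.indicator
      (1 : ℝ × (ℕ → ℝ) → ℝ)) := fun t =>
    have hcoord : ∀ j, Measurable fun z : ℝ × (ℕ → ℝ) => z.2 j :=
      fun j => (measurable_pi_apply j).comp measurable_snd
    measurable_one.indicator
      (measurableSet_eq_fun (hcoord i) (measurable_majorityVote hcoord (tie t) B))
  exact h.tasks_indep.comp _ hmeas

theorem real_mul_min_le_abs_empiricalPseudoCompetence_sub_le (h : IsOpinionModel μ p Y X)
    {tie : ℕ → Finset ℕ → ℝ} (htie : ∀ t A, tie t A = 1 ∨ tie t A = -1) (N i : ℕ) {T : ℕ}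
    (hT : 1 ≤ T) {r : ℝ} (hr : r ∈ Set.Icc 0 (22 / 25)) :
    μ.real {ω | r * min (pseudoCompetence p N i) (1 - pseudoCompetence p N i) ≤
      |empiricalPseudoCompetence X tie N T i ω - pseudoCompetence p N i|} ≤
      2 * Real.exp (-(T * min (pseudoCompetence p N i) (1 - pseudoCompetence p N i) *
        (3 / 8 * r ^ 2))) := by
  simp only [empiricalPseudoCompetence_eq]
  have htail := measureReal_mul_min_le_abs_average_sub_le
    (fun t => h.measurableSet_opinion_eq_majorityVote (tie t) ((Finset.range N).erase i) i t)
    (h.iIndepFun_indicator_agreement tie ((Finset.range N).erase i) i)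
    (fun t => h.real_agreement_eq (htie t _) (Finset.notMem_erase i _) t)
    (Finset.nonempty_range_iff.2 (Nat.one_le_iff_ne_zero.1 hT)) hr
  rwa [Finset.card_range] at htail ⊢

theorem setOf_blockRule_ne_subset (h : IsOpinionModel μ p Y X) (tie : ℕ → Finset ℕ → ℝ)
    (tieB w₀ w₁ : ℝ) (N T t : ℕ) {r : ℝ} (hr : r ∈ Set.Ico 0 1)
    (hq : ∀ i ∈ Finset.range N, pseudoCompetence p N i ∈ Set.Ioo 0 1) :
    {ω | blockRule X tie tieB w₀ w₁ N T t ω ≠ Y t ω} ⊆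
      (⋃ i ∈ Finset.range N,
        {ω | r * min (pseudoCompetence p N i) (1 - pseudoCompetence p N i) ≤
          |empiricalPseudoCompetence X tie N T i ω - pseudoCompetence p N i|}) ∪
      {ω | (∑ i ∈ Finset.range N, X i t ω *
        Real.log (pseudoCompetence p N i / (1 - pseudoCompetence p N i))) * Y t ω ≤
          N * Real.log ((1 + r) / (1 - r))} := by
  intro ω hω
  refine or_iff_not_imp_left.2 fun hgood => ?_
  simp only [Set.mem_iUnion, Set.mem_ofPred_eq, not_exists, not_le] at hgood
  have hweights := sum_mul_mul_le_add_of_abs_sub_le (fun i => h.opinion_values i t ω)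
    (h.state_values t ω) fun i hi => abs_logOddsWeight_sub_le hr (hq i hi) (hgood i hi) w₀ w₁
  rw [Finset.card_range] at hweights
  exact hweights.trans (add_le_of_nonpos_left
    (mul_nonpos_of_signWithTie_ne (h.state_values t ω) hω))

theorem real_blockRule_ne_le (h : IsOpinionModel μ p Y X) {tie : ℕ → Finset ℕ → ℝ}
    (htie : ∀ t A, tie t A = 1 ∨ tie t A = -1) (tieB w₀ w₁ : ℝ) {N T : ℕ} (hT : 1 ≤ T) (t : ℕ)
    {γ r : ℝ} (hγ : 0 ≤ γ) (hq : ∀ i ∈ Finset.range N, pseudoCompetence p N i ∈ Set.Ioo γ (1 - γ))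
    (hr : r ∈ Set.Icc 0 (22 / 25)) :
    μ.real {ω | blockRule X tie tieB w₀ w₁ N T t ω ≠ Y t ω} ≤
      N * (2 * Real.exp (-(T * γ * (3 / 8 * r ^ 2)))) +
        μ.real {ω | (∑ i ∈ Finset.range N, X i t ω *
          Real.log (pseudoCompetence p N i / (1 - pseudoCompetence p N i))) * Y t ω ≤
            N * Real.log ((1 + r) / (1 - r))} := by
  have := h.tasks_indep.isProbabilityMeasure
  have hestimate : ∀ i ∈ Finset.range N,
      μ.real {ω | r * min (pseudoCompetence p N i) (1 - pseudoCompetence p N i) ≤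
        |empiricalPseudoCompetence X tie N T i ω - pseudoCompetence p N i|} ≤
        2 * Real.exp (-(T * γ * (3 / 8 * r ^ 2))) := by
    intro i hi
    refine (h.real_mul_min_le_abs_empiricalPseudoCompetence_sub_le htie N i hT hr).trans ?_
    have hmin : γ ≤ min (pseudoCompetence p N i) (1 - pseudoCompetence p N i) :=
      le_min (hq i hi).1.le (by linarith [(hq i hi).2])
    gcongr
  refine (measureReal_mono (h.setOf_blockRule_ne_subset tie tieB w₀ w₁ N T t
    ⟨hr.1, by linarith [hr.2]⟩ fun i hi => Set.Ioo_subset_Ioo hγ (by linarith) (hq i hi))).trans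
    ((measureReal_union_le _ _).trans (add_le_add_left ?_ _))
  refine (measureReal_biUnion_finset_le _ _).trans ((Finset.sum_le_sum hestimate).trans_eq ?_)
  rw [Finset.sum_const, Finset.card_range, nsmul_eq_mul]

end IsOpinionModel

end OpinionModel

section PseudoWeights

variable {ι : Type*} {p : ι → ℝ} {A : Finset ι} {c c' m γ η D : ℝ} {i : ι}

theorem one_sub_sq_mul_sq_div_le (hγ : 0 < γ) (hη : 0 ≤ η) (hm : |m| ≤ 1 - 2 * γ)
    (hc : 1 - c ≤ η * γ ^ 2 / 2) : (1 - c ^ 2) * (m ^ 2 / (1 - m ^ 2) ^ 2) ≤ η / 4 * |m| := by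
  have hm1 : |m| ≤ 1 := by linarith
  have hsq : m ^ 2 ≤ |m| := by
    rw [← sq_abs, sq]
    exact mul_le_of_le_one_left (abs_nonneg m) hm1
  have hden : 4 * γ ^ 2 ≤ (1 - m ^ 2) ^ 2 := by
    rw [show 4 * γ ^ 2 = (2 * γ) ^ 2 by ring]
    exact pow_le_pow_left₀ (by positivity) (by linarith) 2
  have hnum : 1 - c ^ 2 ≤ η * γ ^ 2 := by linarith [sq_nonneg (1 - c)]
  calc (1 - c ^ 2) * (m ^ 2 / (1 - m ^ 2) ^ 2) ≤ η * γ ^ 2 * (|m| / (4 * γ ^ 2)) := by gcongr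
    _ = η / 4 * |m| := by field_simp

theorem abs_artanh_mul_div_sub_artanh_le_of_abs_sub_le (hγ : 0 < γ) (hη : 0 ≤ η) (hD : 0 ≤ D)
    (hm : |m| ≤ 1 - 2 * γ) (hc : 99 / 100 ≤ c) (hc' : c' ∈ Set.Ioc 0 1)
    (hc'γ : 1 - c' ≤ η * γ ^ 2 / 2) (hcc' : |c' - c| ≤ η / 8 * (|m| + D)) :
    |Real.artanh (c' * m) / c - Real.artanh m| ≤ η * |Real.artanh m| * (|m| + D) := by
  have hm1 : |m| < 1 := by linarith
  have hc0 : 0 < c := by linarith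
  have hc'0 : 0 < c' := hc'.1
  set a := Real.artanh m
  have hnear : |Real.artanh (c' * m) / c' - a| ≤ η / 4 * (|m| + D) * |a| :=
    calc |Real.artanh (c' * m) / c' - a| ≤ (1 - c' ^ 2) * (m ^ 2 / (1 - m ^ 2) ^ 2) * |m| :=
          abs_artanh_mul_div_sub_artanh_le hc' hm1
      _ ≤ η / 4 * (|m| + D) * |a| := by
          refine mul_le_mul ?_ (abs_le_abs_artanh hm1) (abs_nonneg m) (by positivity)
          refine (one_sub_sq_mul_sq_div_le hγ hη hm hc'γ).trans ?_
          gcongr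
          exact le_add_of_nonneg_right hD
  have hsplit : Real.artanh (c' * m) / c - a =
      ((Real.artanh (c' * m) / c' - a) * c' + a * (c' - c)) / c := by
    field_simp
    ring
  rw [hsplit, abs_div, abs_of_pos hc0, div_le_iff₀ hc0]
  calc |(Real.artanh (c' * m) / c' - a) * c' + a * (c' - c)|
      ≤ |Real.artanh (c' * m) / c' - a| * c' + |a| * |c' - c| := by
        refine (abs_add_le _ _).trans_eq ?_
        rw [abs_mul, abs_mul, abs_of_pos hc'0]
    _ ≤ η / 4 * (|m| + D) * |a| * 1 + |a| * (η / 8 * (|m| + D)) := by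
        gcongr
        exact hc'.2
    _ = η * |a| * (|m| + D) * (3 / 8) := by ring
    _ ≤ η * |a| * (|m| + D) * c := by
        gcongr
        linarith

theorem abs_two_mul_sub_one_le {x : ℝ} (hx : x ∈ Set.Ioo γ (1 - γ)) : |2 * x - 1| ≤ 1 - 2 * γ :=
  abs_le.2 ⟨by linarith [hx.1], by linarith [hx.2]⟩

theorem sum_abs_two_mul_sub_one_div_card_le (hp : ∀ i, p i ∈ Set.Icc (0 : ℝ) 1) (A : Finset ι) :
    (∑ j ∈ A, |2 * p j - 1|) / A.card ≤ 1 := by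
  refine div_le_one_of_le₀ ?_ A.card.cast_nonneg
  have hsum := Finset.sum_le_card_nsmul A (fun j => |2 * p j - 1|) 1 fun j _ =>
    abs_le.2 ⟨by linarith [(hp j).1], by linarith [(hp j).2]⟩
  rwa [nsmul_one] at hsum

variable [DecidableEq ι]

theorem abs_meanSign_erase_sub_le_of_one_sub_le (hγ : 0 < γ) (hp : ∀ i, p i ∈ Set.Ioo γ (1 - γ))
    (hA : 1 - meanSign p A ≤ η * γ ^ 4 / 8) (hi : i ∈ A) :
    |meanSign p (A.erase i) - meanSign p A| ≤
      η * γ ^ 2 / 8 * (|2 * p i - 1| + (∑ j ∈ A, |2 * p j - 1|) / A.card) := by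
  have hquot : (1 - meanSign p A) / γ ^ 2 ≤ η * γ ^ 2 / 8 := by
    rw [div_le_iff₀ (by positivity)]
    exact hA.trans_eq (by ring)
  refine (abs_meanSign_erase_sub_le (fun j => ?_) hγ (fun j => (hp j).2.le) hi).trans ?_
  · exact ⟨by linarith [(hp j).1], by linarith [(hp j).2]⟩
  · gcongr

theorem one_sub_meanSign_erase_le (hγ : 0 < γ) (hp : ∀ i, p i ∈ Set.Ioo γ (1 - γ)) (hη : 0 ≤ η)
    (hA : 1 - meanSign p A ≤ η * γ ^ 4 / 8) (hi : i ∈ A) :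
    1 - meanSign p (A.erase i) ≤ η * γ ^ 2 / 2 := by
  have hγ2 : γ ^ 2 ≤ 1 := pow_le_one₀ hγ.le (by linarith [(hp i).1, (hp i).2])
  have hbias : |2 * p i - 1| + (∑ j ∈ A, |2 * p j - 1|) / A.card ≤ 2 := by
    have havg := sum_abs_two_mul_sub_one_div_card_le (p := p)
      (fun j => ⟨by linarith [(hp j).1], by linarith [(hp j).2]⟩) A
    linarith [abs_two_mul_sub_one_le (hp i)]
  have hdiff : |meanSign p (A.erase i) - meanSign p A| ≤ η * γ ^ 2 / 8 * 2 :=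
    (abs_meanSign_erase_sub_le_of_one_sub_le hγ hp hA hi).trans (by gcongr)
  have hγ4 : η * γ ^ 4 ≤ η * γ ^ 2 := by
    rw [show η * γ ^ 4 = η * γ ^ 2 * γ ^ 2 by ring]
    exact mul_le_of_le_one_right (by positivity) hγ2
  linarith [(abs_le.1 hdiff).1, mul_nonneg hη (sq_nonneg γ)]

theorem meanSign_erase_mem_Ioc (hγ : 0 < γ) (hp : ∀ i, p i ∈ Set.Ioo γ (1 - γ))
    (hη : η ∈ Set.Icc 0 (1 / 100)) (hA : 1 - meanSign p A ≤ η * γ ^ 4 / 8) (hi : i ∈ A) :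
    meanSign p (A.erase i) ∈ Set.Ioc 0 1 := by
  have hγ2 : γ ^ 2 ≤ 1 := pow_le_one₀ hγ.le (by linarith [(hp i).1, (hp i).2])
  have hlow := one_sub_meanSign_erase_le hγ hp hη.1 hA hi
  refine ⟨?_, meanSign_le_one (fun j => ⟨by linarith [(hp j).1], by linarith [(hp j).2]⟩) _⟩
  linarith [mul_le_of_le_one_right hη.1 hγ2, hη.2]

theorem ninety_nine_div_hundred_le_meanSign (hγ : γ ∈ Set.Icc 0 1)
    (hη : η ∈ Set.Icc 0 (1 / 100)) (hA : 1 - meanSign p A ≤ η * γ ^ 4 / 8) :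
    99 / 100 ≤ meanSign p A := by
  have hγ4 : γ ^ 4 ≤ 1 := pow_le_one₀ hγ.1 hγ.2
  linarith [mul_le_of_le_one_right hη.1 hγ4, hη.2]

theorem abs_artanh_div_meanSign_sub_artanh_le (hγ : 0 < γ) (hp : ∀ i, p i ∈ Set.Ioo γ (1 - γ))
    (hη : η ∈ Set.Icc 0 (1 / 100)) (hA : 1 - meanSign p A ≤ η * γ ^ 4 / 8) (hi : i ∈ A) :
    |Real.artanh (meanSign p (A.erase i) * (2 * p i - 1)) / meanSign p A -
        Real.artanh (2 * p i - 1)| ≤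
      η * |Real.artanh (2 * p i - 1)| *
        (|2 * p i - 1| + (∑ j ∈ A, |2 * p j - 1|) / A.card) := by
  have hγ1 : γ ≤ 1 := by linarith [(hp i).1, (hp i).2]
  have hη0 : 0 ≤ η := hη.1
  refine abs_artanh_mul_div_sub_artanh_le_of_abs_sub_le hγ hη0 (by positivity)
    (abs_two_mul_sub_one_le (hp i)) (ninety_nine_div_hundred_le_meanSign ⟨hγ.le, hγ1⟩ hη hA)
    (meanSign_erase_mem_Ioc hγ hp hη hA hi) (one_sub_meanSign_erase_le hγ hp hη0 hA hi)
    ((abs_meanSign_erase_sub_le_of_one_sub_le hγ hp hA hi).trans ?_)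
  gcongr
  exact mul_le_of_le_one_right hη0 (pow_le_one₀ hγ.le hγ1)

theorem log_pseudoCompetence_div {N i : ℕ} {p : ℕ → ℝ} (hp : p i ∈ Set.Ioo 0 1)
    (hc : meanSign p ((Finset.range N).erase i) ∈ Set.Ioc 0 1) :
    Real.log (pseudoCompetence p N i / (1 - pseudoCompetence p N i)) =
      2 * Real.artanh (meanSign p ((Finset.range N).erase i) * (2 * p i - 1)) := by
  have hmem : pseudoCompetence p N i ∈ Set.Ioo 0 1 := by
    have hp0 : p i ∈ Set.Ioo 0 (1 - 0) := by rwa [sub_zero]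
    simpa only [sub_zero] using pseudoCompetence_mem_Ioo hp0 hc
  rw [log_div_one_sub_eq_artanh hmem, pseudoCompetence]
  ring_nf

end PseudoWeights

section BalancedCommittee

variable {p : ℕ → ℝ} {γ : ℝ} {N : ℕ}

/-- The relative precision with which the weights of a committee with balancing parameter `γ` are
approximated. The `cosh` makes the second-order error of the weights smaller than the fourth-order
gain in `log_cosh_sub_div_cosh_le`. -/
noncomputable def weightPrecision (γ : ℝ) : ℝ := 1 / (100 * Real.cosh (3 * Real.artanh (1 - 2 * γ)))

/-- How far the expected sign of the majority of a committee with balancing parameter `γ` may stay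
below `1` for its pseudo competences to determine the weights with the precision
`weightPrecision γ`. -/
noncomputable def meanSignTolerance (γ : ℝ) : ℝ := weightPrecision γ * γ ^ 4 / 8

theorem weightPrecision_pos (γ : ℝ) : 0 < weightPrecision γ :=
  one_div_pos.2 (mul_pos (by norm_num) (Real.cosh_pos _))

theorem weightPrecision_mem_Icc (γ : ℝ) : weightPrecision γ ∈ Set.Icc 0 (1 / 100) :=
  ⟨(weightPrecision_pos γ).le, one_div_le_one_div_of_le (by norm_num)
    (by linarith [Real.one_le_cosh (3 * Real.artanh (1 - 2 * γ))])⟩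

theorem eight_mul_cosh_sq_mul_weightPrecision_sq_le (γ : ℝ) :
    8 * Real.cosh (3 * Real.artanh (1 - 2 * γ)) ^ 2 * (4 * weightPrecision γ ^ 2) ≤ 1 := by
  have := Real.cosh_pos (3 * Real.artanh (1 - 2 * γ))
  rw [weightPrecision]
  field_simp
  norm_num

theorem meanSignTolerance_pos (hγ : 0 < γ) : 0 < meanSignTolerance γ :=
  div_pos (mul_pos (weightPrecision_pos γ) (pow_pos hγ 4)) (by norm_num)

theorem committeePotential_eq_sum_artanh (hp : ∀ i, p i ∈ Set.Ioo (0 : ℝ) 1) (N : ℕ) :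
    committeePotential p N = ∑ i ∈ Finset.range N,
      Real.artanh (2 * p i - 1) * Real.tanh (Real.artanh (2 * p i - 1)) := by
  refine Finset.sum_congr rfl fun i _ => ?_
  rw [log_div_one_sub_eq_artanh (hp i),
    Real.tanh_artanh ⟨by linarith [(hp i).1], by linarith [(hp i).2]⟩]
  ring

theorem IsAbsolutelyBalanced.mem_Ioo (h : IsAbsolutelyBalanced p γ) (i : ℕ) :
    p i ∈ Set.Ioo (0 : ℝ) 1 :=
  ⟨h.1.1.trans (h.2 i).1, by linarith [h.1.1, (h.2 i).2]⟩

theorem IsAbsolutelyBalanced.abs_artanh_le (h : IsAbsolutelyBalanced p γ) (i : ℕ) :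
    |Real.artanh (2 * p i - 1)| ≤ Real.artanh (1 - 2 * γ) := by
  have habs := abs_two_mul_sub_one_le (h.2 i)
  rw [abs_artanh (by linarith [h.1.1])]
  exact Real.artanh_le_artanh (by linarith [abs_nonneg (2 * p i - 1)]) (by linarith [h.1.1]) habs

theorem IsAbsolutelyBalanced.prod_cosh_pseudoWeight_le (h : IsAbsolutelyBalanced p γ)
    (hA : 1 - meanSign p (Finset.range N) ≤ meanSignTolerance γ) {l : ℝ}
    (hl : l ∈ Set.Icc (0 : ℝ) (1 / 2)) :
    ∏ i ∈ Finset.range N, (Real.cosh (Real.artanh (2 * p i - 1) - 2 * l *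
        (Real.artanh (meanSign p ((Finset.range N).erase i) * (2 * p i - 1)) /
          meanSign p (Finset.range N))) / Real.cosh (Real.artanh (2 * p i - 1))) ≤
      Real.exp (2 * committeePotential p N *
        (l ^ 2 - l + 2 * weightPrecision γ * l * (1 - 2 * l))) := by
  obtain ⟨hη0, hη1⟩ := weightPrecision_mem_Icc γ
  have hp : ∀ i, p i ∈ Set.Icc (0 : ℝ) 1 := fun i => Set.Ioo_subset_Icc_self (h.mem_Ioo i)
  have habs : ∀ i, |2 * p i - 1| < 1 := fun i =>
    (abs_two_mul_sub_one_le (h.2 i)).trans_lt (by linarith [h.1.1])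
  have hweight := fun i hi =>
    abs_artanh_div_meanSign_sub_artanh_le (i := i) h.1.1 h.2 ⟨hη0, hη1⟩ hA hi
  rw [committeePotential_eq_sum_artanh h.mem_Ioo]
  refine prod_cosh_sub_div_cosh_le _ (fun i _ => h.abs_artanh_le i) hl (by linarith)
    (fun i hi => (hweight i hi).trans ?_) ?_
  · have havg := sum_abs_two_mul_sub_one_div_card_le hp (Finset.range N)
    calc _ ≤ weightPrecision γ * |Real.artanh (2 * p i - 1)| * (1 + 1) := by
          gcongr
          exact (habs i).le
      _ = 2 * weightPrecision γ * |Real.artanh (2 * p i - 1)| := by ring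
  · have hsum := sum_sq_le_of_abs_le_mul_add_avg _
      (fun i _ => abs_le_abs_artanh (habs i)) hweight
    calc _ ≤ 8 * Real.cosh (3 * Real.artanh (1 - 2 * γ)) ^ 2 * (4 * weightPrecision γ ^ 2 *
          ∑ i ∈ Finset.range N, Real.artanh (2 * p i - 1) ^ 4) := by gcongr
      _ = 8 * Real.cosh (3 * Real.artanh (1 - 2 * γ)) ^ 2 * (4 * weightPrecision γ ^ 2) *
          ∑ i ∈ Finset.range N, Real.artanh (2 * p i - 1) ^ 4 := by ring
      _ ≤ _ := mul_le_of_le_one_left (Finset.sum_nonneg fun i _ => Even.pow_nonneg (by decide) _)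
        (eight_mul_cosh_sq_mul_weightPrecision_sq_le γ)

theorem IsAbsolutelyBalanced.prod_exp_pseudoWeight_le (h : IsAbsolutelyBalanced p γ)
    (hA : 1 - meanSign p (Finset.range N) ≤ meanSignTolerance γ) {l : ℝ}
    (hl : l ∈ Set.Icc (0 : ℝ) (1 / 2)) :
    ∏ i ∈ Finset.range N,
        (p i * Real.exp (-(l / meanSign p (Finset.range N) *
            Real.log (pseudoCompetence p N i / (1 - pseudoCompetence p N i)))) +
          (1 - p i) * Real.exp (l / meanSign p (Finset.range N) *
            Real.log (pseudoCompetence p N i / (1 - pseudoCompetence p N i)))) ≤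
      Real.exp (2 * committeePotential p N *
        (l ^ 2 - l + 2 * weightPrecision γ * l * (1 - 2 * l))) := by
  refine (Finset.prod_congr rfl fun i hi => ?_).trans_le (h.prod_cosh_pseudoWeight_le hA hl)
  have hpi := h.mem_Ioo i
  rw [cosh_sub_div_cosh, Real.tanh_artanh ⟨by linarith [hpi.1], by linarith [hpi.2]⟩,
    log_pseudoCompetence_div hpi
      (meanSign_erase_mem_Ioc h.1.1 h.2 (weightPrecision_mem_Icc γ) hA hi)]
  ring_nf

theorem chernoff_exponent_le {Φ x K c l η : ℝ} (hΦ : 0 < Φ) (hx : 0 ≤ x)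
    (hlx : 2 * Φ * (1 - 2 * l) = x) (hl : 0 ≤ l) (hc : 99 / 100 ≤ c) (hη : η ≤ 1 / 100)
    (hK : K ≤ 97 / 100 * x) :
    l / c * K + 2 * Φ * (l ^ 2 - l + 2 * η * l * (1 - 2 * l)) ≤ -(2 * Φ - x) ^ 2 / (8 * Φ) := by
  have hquot : l / c ≤ l * (100 / 99) := by
    rw [div_le_iff₀ (by linarith)]
    linarith [mul_le_mul_of_nonneg_left hc hl]
  have hthreshold : l / c * K ≤ 97 / 99 * (l * x) :=
    calc l / c * K ≤ l / c * (97 / 100 * x) := by gcongr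
      _ ≤ l * (100 / 99) * (97 / 100 * x) := by gcongr
      _ = 97 / 99 * (l * x) := by ring
  have hcumulant : 2 * Φ * (l ^ 2 - l + 2 * η * l * (1 - 2 * l)) =
      -(2 * Φ * l ^ 2) - l * x + 2 * η * (l * x) := by
    rw [← hlx]
    ring
  have hbound : -(2 * Φ - x) ^ 2 / (8 * Φ) = -(2 * Φ * l ^ 2) := by
    rw [← hlx]
    field_simp
    ring
  rw [hcumulant, hbound]
  linarith [mul_le_mul_of_nonneg_right hη (mul_nonneg hl hx), mul_nonneg hl hx]

theorem IsOpinionModel.real_pseudoWeighted_sum_mul_state_le {Ω : Type*} [MeasurableSpace Ω]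
    {μ : Measure Ω} {Y : ℕ → Ω → ℝ} {X : ℕ → ℕ → Ω → ℝ} (h : IsOpinionModel μ p Y X)
    (hγ : IsAbsolutelyBalanced p γ)
    (hA : 1 - meanSign p (Finset.range N) ≤ meanSignTolerance γ) {ε K : ℝ}
    (hε : ε ∈ Set.Ico 0 (2 * committeePotential p N / N)) (hK : K ≤ N * (97 / 100 * ε)) (t : ℕ) :
    μ.real {ω | (∑ i ∈ Finset.range N, X i t ω *
        Real.log (pseudoCompetence p N i / (1 - pseudoCompetence p N i))) * Y t ω ≤ K} ≤
      Real.exp (-(2 * committeePotential p N - ε * N) ^ 2 / (8 * committeePotential p N)) := by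
  obtain ⟨hε0, hεΦ⟩ := hε
  have hη := weightPrecision_mem_Icc γ
  have hN : (0 : ℝ) < N := N.cast_nonneg.lt_of_ne' fun hN => by
    rw [hN, div_zero] at hεΦ
    exact hεΦ.not_ge hε0
  rw [lt_div_iff₀ hN] at hεΦ
  set Φ := committeePotential p N
  have hx : 0 ≤ ε * N := by positivity
  have hΦ : 0 < Φ := by linarith
  set l := 1 / 2 * (1 - ε * N / (2 * Φ)) with hl
  have hlx : 2 * Φ * (1 - 2 * l) = ε * N := by
    rw [hl]
    field_simp
    ring
  have hl_mem : l ∈ Set.Icc (0 : ℝ) (1 / 2) := by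
    have hle : ε * N / (2 * Φ) ≤ 1 := (div_le_one (by positivity)).2 hεΦ.le
    have hnn : 0 ≤ ε * N / (2 * Φ) := by positivity
    constructor <;> linarith
  have hc : 99 / 100 ≤ meanSign p (Finset.range N) :=
    ninety_nine_div_hundred_le_meanSign ⟨hγ.1.1.le, by linarith [hγ.1.2]⟩ hη hA
  refine (h.real_sum_mul_state_le (fun i => Set.Ioo_subset_Icc_self (hγ.mem_Ioo i)) _ _ K
    (div_nonneg hl_mem.1 ((by norm_num : (0 : ℝ) ≤ 99 / 100).trans hc)) t).trans ?_
  refine (mul_le_mul_of_nonneg_left (hγ.prod_exp_pseudoWeight_le hA hl_mem)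
    (Real.exp_pos _).le).trans ?_
  rw [← Real.exp_add, Real.exp_le_exp]
  exact chernoff_exponent_le hΦ hx hlx hl_mem.1 hc hη.2 (hK.trans_eq (by ring))

end BalancedCommittee

section EstimationRadius

variable {ε : ℝ}

/-- The relative precision demanded from the empirical pseudo competences, as a function of the
precision `ε` of the weights. With `s = (√(4ε + 1) - 1) / 2`, the positive root of `s ^ 2 + s = ε`,
it is `12 / 25 * s`. -/
noncomputable def estimationRadius (ε : ℝ) : ℝ := 6 / 25 * (√(4 * ε + 1) - 1)

theorem one_lt_sqrt_four_mul_add_one (hε : 0 < ε) : 1 < √(4 * ε + 1) :=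
  Real.lt_sqrt_of_sq_lt (by linarith)

theorem estimationRadius_mem_Icc (hε : ε ∈ Set.Ioo 0 5) :
    estimationRadius ε ∈ Set.Icc 0 (22 / 25) := by
  have hsqrt : √(4 * ε + 1) ≤ 14 / 3 :=
    Real.sqrt_le_iff.2 ⟨by norm_num, by linarith [hε.2]⟩
  rw [estimationRadius]
  exact ⟨by linarith [one_lt_sqrt_four_mul_add_one hε.1], by linarith⟩

theorem log_one_add_estimationRadius_div_le (hε : ε ∈ Set.Ioo 0 5) :
    Real.log ((1 + estimationRadius ε) / (1 - estimationRadius ε)) ≤ 97 / 100 * ε := by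
  obtain ⟨hr0, hr1⟩ := estimationRadius_mem_Icc hε
  refine (log_one_add_div_one_sub_le hr0 hr1).trans ?_
  have hsq := Real.sq_sqrt (by linarith [hε.1] : 0 ≤ 4 * ε + 1)
  rw [estimationRadius]
  linarith [sq_nonneg (√(4 * ε + 1) - 1), one_lt_sqrt_four_mul_add_one hε.1]

theorem log_le_of_sampleConstant_mul_lt {δ γ : ℝ} {N T : ℕ} (hT : 1 ≤ T) (hε : 0 < ε) (hγ : 0 ≤ γ)
    (h : sampleConstant δ N T * (2 / (√(4 * ε + 1) - 1)) ^ 2 < γ) :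
    Real.log (8 * N / δ) ≤ T * γ * (3 / 8 * estimationRadius ε ^ 2) := by
  have hs : 0 < √(4 * ε + 1) - 1 := sub_pos.2 (one_lt_sqrt_four_mul_add_one hε)
  have : (0 : ℝ) < T := by exact_mod_cast hT
  rw [estimationRadius]
  set s := √(4 * ε + 1) - 1
  have hlog : 48 * Real.log (8 * N / δ) < T * γ * s ^ 2 :=
    calc 48 * Real.log (8 * N / δ) = sampleConstant δ N T * (2 / s) ^ 2 * (T * s ^ 2) := by
          rw [sampleConstant]
          field_simp
          ring
      _ < γ * (T * s ^ 2) := by gcongr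
      _ = T * γ * s ^ 2 := by ring
  have hnonneg : 0 ≤ T * γ * s ^ 2 := by positivity
  linarith

theorem mul_exp_estimationRadius_le {δ γ : ℝ} {N T : ℕ} (hN : 0 < N) (hT : 1 ≤ T) (hδ : 0 < δ)
    (hε : 0 < ε) (hγ : 0 ≤ γ) (h : sampleConstant δ N T * (2 / (√(4 * ε + 1) - 1)) ^ 2 < γ) :
    N * (2 * Real.exp (-(T * γ * (3 / 8 * estimationRadius ε ^ 2)))) ≤ δ := by
  have : (0 : ℝ) < N := by exact_mod_cast hN
  calc N * (2 * Real.exp (-(T * γ * (3 / 8 * estimationRadius ε ^ 2))))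
      ≤ N * (2 * Real.exp (-Real.log (8 * N / δ))) := by
        gcongr
        exact log_le_of_sampleConstant_mul_lt hT hε hγ h
    _ = δ / 4 := by
        rw [Real.exp_neg, Real.exp_log (by positivity)]
        field_simp
        norm_num
    _ ≤ δ := by linarith

end EstimationRadius

section ErrorBound

variable {Ω : Type*} [MeasurableSpace Ω] {μ : Measure Ω} {p : ℕ → ℝ} {Y : ℕ → Ω → ℝ}
  {X : ℕ → ℕ → Ω → ℝ} {tie : ℕ → Finset ℕ → ℝ}

theorem IsOpinionModel.tendsto_meanSign (h : IsOpinionModel μ p Y X)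
    (htie : ∀ t A, tie t A = 1 ∨ tie t A = -1) (hcons : IsConsistent μ Y X tie) :
    Tendsto (fun n => meanSign p (Finset.range n)) atTop (𝓝 1) := by
  have hlim := (hcons.const_mul 2).sub_const 1
  norm_num only at hlim
  refine hlim.congr fun n => ?_
  rw [h.majorityAccuracy_eq htie]
  ring

theorem IsOpinionModel.real_blockRule_ne_le_add_exp (h : IsOpinionModel μ p Y X)
    (htie : ∀ t A, tie t A = 1 ∨ tie t A = -1) {γ₀ : ℝ} (hγ₀ : IsAbsolutelyBalanced p γ₀) {N T : ℕ}
    (hN : 0 < N) (hA : 1 - meanSign p (Finset.range N) ≤ meanSignTolerance γ₀) (hT : 1 ≤ T)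
    {δ ε γ : ℝ} (hδ : 0 < δ) (hε : ε ∈ Set.Ioo 0 (min 5 (2 * committeePotential p N / N)))
    (hγ : IsAbsolutelyBalanced p γ)
    (hC : sampleConstant δ N T * (2 / (√(4 * ε + 1) - 1)) ^ 2 < γ) (tieB w₀ w₁ : ℝ) (t : ℕ) :
    μ.real {ω | blockRule X tie tieB w₀ w₁ N T t ω ≠ Y t ω} ≤
      δ + Real.exp (-(2 * committeePotential p N - ε * N) ^ 2 / (8 * committeePotential p N)) := by
  obtain ⟨hε0, hε1⟩ := hε
  obtain ⟨hε5, hεΦ⟩ := lt_min_iff.1 hε1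
  have hq : ∀ i ∈ Finset.range N, pseudoCompetence p N i ∈ Set.Ioo γ (1 - γ) := fun i hi =>
    pseudoCompetence_mem_Ioo (hγ.2 i)
      (meanSign_erase_mem_Ioc hγ₀.1.1 hγ₀.2 (weightPrecision_mem_Icc γ₀) hA hi)
  refine (h.real_blockRule_ne_le htie tieB w₀ w₁ hT t hγ.1.1.le hq
    (estimationRadius_mem_Icc ⟨hε0, hε5⟩)).trans (add_le_add ?_ ?_)
  · exact mul_exp_estimationRadius_le hN hT hδ hε0 hγ.1.1.le hC
  · refine h.real_pseudoWeighted_sum_mul_state_le hγ₀ hA ⟨hε0.le, hεΦ⟩ ?_ t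
    gcongr
    exact log_one_add_estimationRadius_div_le ⟨hε0, hε5⟩

end ErrorBound

-- Junk value: for `x < 0` this power is `|x| ^ (1 / 3) * cos (π / 3)`.
theorem rpow_one_third_nonneg (x : ℝ) : 0 ≤ x ^ ((1 : ℝ) / 3) := by
  rcases le_or_gt 0 x with hx | hx
  · exact Real.rpow_nonneg hx _
  · rw [Real.rpow_def_of_neg hx, one_div_mul_eq_div, Real.cos_pi_div_three]
    positivity

theorem theorem4_general (p : ℕ → ℝ) :
    ∃ nstar : ℕ, ∀ {Ω : Type*} [MeasurableSpace Ω] (μ : Measure Ω)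
      (Y : ℕ → Ω → ℝ) (X : ℕ → ℕ → Ω → ℝ), IsOpinionModel μ p Y X →
      ∀ tie : ℕ → Finset ℕ → ℝ, (∀ t A, tie t A = 1 ∨ tie t A = -1) →
      IsConsistent μ Y X tie →
      ∀ N : ℕ, nstar < N → ∀ T : ℕ, 1 ≤ T →
      ∀ δ > 0, ∀ ε ∈ Set.Ioo 0 (min 5 (2 * committeePotential p N / N)),
      ∀ γ : ℝ, IsAbsolutelyBalanced p γ →
        sampleConstant δ N T * (2 / (Real.sqrt (4 * ε + 1) - 1)) ^ 2 < γ →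
        ∀ (tieB w₀ w₁ : ℝ) (t : ℕ),
          μ.real {ω | blockRule X tie tieB w₀ w₁ N T t ω ≠ Y t ω} ≤
            δ + Real.exp (-(2 * committeePotential p N - ε * N) ^ 2 /
              (8 * committeePotential p N)) := by
  by_cases hp : (∃ γ, IsAbsolutelyBalanced p γ) ∧
      Tendsto (fun n => meanSign p (Finset.range n)) atTop (𝓝 1)
  · obtain ⟨⟨γ₀, hγ₀⟩, hlim⟩ := hp
    obtain ⟨n₀, hn₀⟩ := eventually_atTop.1
      (hlim.eventually_const_le (sub_lt_self 1 (meanSignTolerance_pos hγ₀.1.1)))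
    refine ⟨n₀, fun μ Y X h tie htie _ N hN T hT δ hδ ε hε γ hγ hC tieB w₀ w₁ t => ?_⟩
    exact h.real_blockRule_ne_le_add_exp htie hγ₀ (Nat.zero_lt_of_lt hN)
      (sub_le_comm.1 (hn₀ N hN.le)) hT hδ hε hγ hC tieB w₀ w₁ t
  · refine ⟨0, fun μ Y X h tie htie hcons N _ T _ δ _ ε _ γ hγ => ?_⟩
    exact absurd ⟨⟨γ, hγ⟩, h.tendsto_meanSign htie hcons⟩ hp

theorem theorem4 (p : ℕ → ℝ) :
    ∃ nstar : ℕ, ∀ {Ω : Type*} [MeasurableSpace Ω] (μ : Measure Ω) [IsProbabilityMeasure μ]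
      (Y : ℕ → Ω → ℝ) (X : ℕ → ℕ → Ω → ℝ), IsOpinionModel μ p Y X →
      ∀ tie : ℕ → Finset ℕ → ℝ, (∀ t A, tie t A = 1 ∨ tie t A = -1) →
      IsConsistent μ Y X tie →
      ∀ N : ℕ, nstar < N → ∀ T : ℕ, 1 ≤ T →
      ∀ δ ∈ Set.Ioo (0 : ℝ) 1,
      ∀ ε ∈ Set.Ioo
          ((rateRatio (consistencyRate μ Y X tie N) * sampleConstant δ N T) ^ ((1 : ℝ) / 3))
          (min 5 (2 * committeePotential p N / N)),
      ∀ γ : ℝ, IsAbsolutelyBalanced p γ →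
        sampleConstant δ N T * (2 / (Real.sqrt (4 * ε + 1) - 1)) ^ 2 < γ →
        ∀ tieB w₀ w₁ : ℝ, (tieB = 1 ∨ tieB = -1) → ∀ t : ℕ,
          μ.real {ω | blockRule X tie tieB w₀ w₁ N T t ω ≠ Y t ω} ≤
            δ + Real.exp (-(2 * committeePotential p N - ε * N) ^ 2 /
              (8 * committeePotential p N)) := by
  obtain ⟨nstar, hn⟩ := theorem4_general p
  exact ⟨nstar, fun μ _ Y X h tie htie hcons N hN T hT δ hδ ε hε γ hγ hC tieB w₀ w₁ _ =>
    hn μ Y X h tie htie hcons N hN T hT δ hδ.1 ε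
      ⟨(rpow_one_third_nonneg _).trans_lt hε.1, hε.2⟩ γ hγ hC tieB w₀ w₁⟩
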